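/- **Theorem (equivalence of the two definitions of the Bloch spectrum).** Let $G$ be a quantum graph: a finite connected multigraph (loops and multiple edges allowed) with vertex set $V$ and non-empty edge set $E$, with a length $L(e)>0$ for each edge; choose an orientation of each edge $e$ and identify $e$ with $[0,L(e)]$ accordingly. For an edge end $(v,e)$ let $\nu_{v,e}$ be the outward unit normal of $e$ at $v$ (a loop has two ends at its vertex). *Forms.* A real $0$-form is a real function on $G$ that is $C^\infty$ on each closed edge, continuous at the vertices, and satisfies the Kirchhoff condition $\sum_{e\sim v}\nu_{v,e}(f|_e)=0$ at every vertex $v$. A real $1$-form $\alpha$ consists of a smooth real $1$-form $\alpha_e$ on each closed edge with $\sum_{e\sim v}\alpha_e(\nu_{v,e})=0$ at every $v$. Let $H^1_{dR}(G,\mathbb R)$ be the space of real $1$-forms modulo differentials of real $0$-forms, and let $H^1_{dR}(G,\mathbb Z)$ be the subgroup of those classes that have a representative with integral pairing with every element of $H_1(G,\mathbb Z)$. *Bloch spectrum.* For a real $1$-form $\alpha$ let $d_\alpha f=f'+2\pi i\,\alpha f$ and $\Delta_\alpha=d_\alpha^*d_\alpha$, where $d_\alpha^*\beta=-\beta'-2\pi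 i\,\alpha\beta$, on the domain of all complex functions that are in the Sobolev space $W_2$ of each edge, are continuous at the vertices, and satisfy the Kirchhoff condition. Let $\mathrm{Spec}_\alpha(G)$ be the set of eigenvalues of $\Delta_\alpha$ with multiplicities. *$\pi_1$-spectrum.* Let $v_0\in V$, let $\pi_1(G)=\pi_1(G,v_0)$ be the group of closed edge paths at $v_0$ up to insertion and deletion of backtracks, and let $\tilde G$ be the universal cover of $G$, a metric tree on which $\pi_1(G)$ acts by deck transformations. For a unitary character, i.e. a homomorphism $\chi:\pi_1(G)\to U(1)=\{z\in\mathbb C:|z|=1\}$, let $\mathrm{Spec}(G,\chi)$ be the set of eigenvalues, with multiplicities, of the standard Laplacian $d^*d$ on the functions $\tilde f:\tilde G\to\mathbb C$ that are in $W_2$ on each edge, are continuous, satisfy the Kirchhoff condition at every vertex of $\tilde G$, and obey $\tilde f(\gamma x)=\chi(\gamma)\tilde f(x)$ for all $x\in\tilde G$ and $\gamma\in\pi_1(G)$. Then $\mathrm{Spec}_\alpha(G)$ depends only on the class of $\alpha$ in $H^1_{dR}(G,\mathbb R)/H^1_{dR}(G,\mathbb Z)$, and $$[\alpha]\longmapsto\chi_\alpha,\qquad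 \chi_\alpha(\gamma)=e^{-2\pi i\int_\gamma\alpha},$$ is a well-defined bijection from $H^1_{dR}(G,\mathbb R)/H^1_{dR}(G,\mathbb Z)$ onto the set of unitary characters of $\pi_1(G)$. Under this bijection the Bloch spectrum $[\alpha]\mapsto \mathrm{Spec}_\alpha(G)$ and the $\pi_1$-spectrum $\chi\mapsto\mathrm{Spec}(G,\chi)$ coincide: $\mathrm{Spec}(G,\chi_\alpha)=\mathrm{Spec}_\alpha(G)$ for every real $1$-form $\alpha$. -/

import Mathlib

open MeasureTheory CategoryTheory
open scoped ContDiff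

universe u v

set_option linter.checkUnivs false

/-- A directed combinatorial multigraph (loops and multiple edges allowed) in which only finitely
many edges meet at each vertex, together with a positive length for each edge.  The edge `e` is
identified with the interval `[0, length e]`, the point `0` being glued to the vertex `init e` and
the point `length e` to the vertex `term e`.  A quantum graph is a metric graph with finitely many
vertices and edges; infinite metric graphs occur as universal covers of quantum graphs. -/
structure MetricGraph where
  V : Type u
  E : Type v
  init : E → V
  term : E → V
  length : E → ℝ
  length_pos : ∀ e, 0 < length e
  finite_init : ∀ w, {e | init e = w}.Finite
  finite_term : ∀ w, {e | term e = w}.Finite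

namespace MetricGraph

noncomputable section

variable (G : MetricGraph.{u, v})

/-- Any two vertices are joined by a path, where edges may be passed in both directions. -/
def Connected : Prop :=
  ∀ a b : G.V, Relation.ReflTransGen (fun x y => ∃ e : G.E,
    (G.init e = x ∧ G.term e = y) ∨ (G.init e = y ∧ G.term e = x)) a b

/-! ### Functions and forms -/

/-- The closed interval with which the edge `e` is identified. -/
abbrev Seg (e : G.E) : Type := Set.Icc (0 : ℝ) (G.length e)

/-- Lebesgue measure on the edge `e`. -/
def segMeasure (e : G.E) : Measure (G.Seg e) := volume.comap Subtype.val

/-- The point of the edge `e` that is glued to its initial vertex. -/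
def start (e : G.E) : G.Seg e := ⟨0, le_rfl, (G.length_pos e).le⟩

/-- The point of the edge `e` that is glued to its terminal vertex. -/
def finish (e : G.E) : G.Seg e := ⟨G.length e, (G.length_pos e).le, le_rfl⟩

/-- A function on each closed edge; in general multivalued at the vertices.  A `1`-form is the
family of its values on the unit vector fields pointing from `init e` to `term e`. -/
abbrev EdgeFun (F : Type) : Type v := (e : G.E) → G.Seg e → F

variable {G}

/-- The function on the edge `e`, extended constantly to a function on the real line. -/
def EdgeFun.onLine {F : Type} (f : G.EdgeFun F) (e : G.E) : ℝ → F :=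
  Set.IccExtend (G.length_pos e).le (f e)

/-- The derivative on each closed edge in the direction from `init e` to `term e`
(one-sided at the end points). -/
def EdgeFun.D {F : Type} [NormedAddCommGroup F] [NormedSpace ℝ F] (f : G.EdgeFun F) :
    G.EdgeFun F :=
  fun e x => derivWithin (f.onLine e) (Set.Icc 0 (G.length e)) x

/-- `C^∞` on each closed edge. -/
def EdgeFun.Smooth {F : Type} [NormedAddCommGroup F] [NormedSpace ℝ F] (f : G.EdgeFun F) : Prop :=
  ∀ e, ContDiffOn ℝ ∞ (f.onLine e) (Set.Icc 0 (G.length e))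

/-- Continuity at the vertices: all edges that meet at a vertex have the same value there. -/
def EdgeFun.MatchesAtVertices {F : Type} (f : G.EdgeFun F) : Prop :=
  ∃ u : G.V → F, ∀ e, f e (G.start e) = u (G.init e) ∧ f e (G.finish e) = u (G.term e)

/-- The sum at the vertex `w` of the values of the `1`-form `a` on the outward unit normals of all
edge ends at `w`.  A loop contributes with both of its ends. -/
def EdgeFun.outwardSum {F : Type} [AddCommGroup F] (a : G.EdgeFun F) (w : G.V) : F :=
  ∑ e ∈ (G.finite_term w).toFinset, a e (G.finish e)
    - ∑ e ∈ (G.finite_init w).toFinset, a e (G.start e)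

theorem EdgeFun.onLine_val {F : Type} (f : G.EdgeFun F) (e : G.E) (x : G.Seg e) :
    f.onLine e x = f e x := Set.IccExtend_val _ _ _

theorem EdgeFun.onLine_add {F : Type} [AddCommGroup F] (f g : G.EdgeFun F) (e : G.E) :
    (f + g).onLine e = f.onLine e + g.onLine e := rfl

theorem EdgeFun.onLine_smul {𝕜 F : Type} [SMul 𝕜 F] (c : 𝕜) (f : G.EdgeFun F) (e : G.E) :
    (c • f).onLine e = c • f.onLine e := rfl

theorem EdgeFun.outwardSum_add {F : Type} [AddCommGroup F] (f g : G.EdgeFun F) (w : G.V) :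
    (f + g).outwardSum w = f.outwardSum w + g.outwardSum w := by
  simp only [EdgeFun.outwardSum, Pi.add_apply, Finset.sum_add_distrib]
  abel

theorem EdgeFun.outwardSum_smul {𝕜 F : Type} [AddCommGroup F] [Ring 𝕜] [Module 𝕜 F] (c : 𝕜)
    (f : G.EdgeFun F) (w : G.V) : (c • f).outwardSum w = c • f.outwardSum w := by
  simp only [EdgeFun.outwardSum, Pi.smul_apply, Finset.smul_sum, smul_sub]

theorem EdgeFun.uniqueDiffWithinAt (e : G.E) (x : G.Seg e) :
    UniqueDiffWithinAt ℝ (Set.Icc 0 (G.length e)) (x : ℝ) :=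
  uniqueDiffOn_Icc (G.length_pos e) x x.2

theorem EdgeFun.D_add_apply {F : Type} [NormedAddCommGroup F] [NormedSpace ℝ F] {f g : G.EdgeFun F}
    {e : G.E} {x : G.Seg e}
    (hf : DifferentiableWithinAt ℝ (f.onLine e) (Set.Icc 0 (G.length e)) x)
    (hg : DifferentiableWithinAt ℝ (g.onLine e) (Set.Icc 0 (G.length e)) x) :
    (f + g).D e x = f.D e x + g.D e x := by
  rw [EdgeFun.D, EdgeFun.onLine_add]
  exact derivWithin_add hf hg

theorem EdgeFun.D_smul {𝕜 F : Type} [NormedAddCommGroup F] [NormedSpace ℝ F] [NormedField 𝕜]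
    [NormedSpace 𝕜 F] [SMulCommClass ℝ 𝕜 F] (c : 𝕜) (f : G.EdgeFun F) :
    (c • f).D = c • f.D := by
  funext e x
  rw [EdgeFun.D, EdgeFun.onLine_smul]
  exact derivWithin_const_smul_field c _

theorem EdgeFun.Smooth.differentiableWithinAt {F : Type} [NormedAddCommGroup F] [NormedSpace ℝ F]
    {f : G.EdgeFun F} (hf : f.Smooth) (e : G.E) (x : G.Seg e) :
    DifferentiableWithinAt ℝ (f.onLine e) (Set.Icc 0 (G.length e)) x :=
  (hf e).differentiableOn (by simp) x x.2

theorem EdgeFun.Smooth.D {F : Type} [NormedAddCommGroup F] [NormedSpace ℝ F]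
    {f : G.EdgeFun F} (hf : f.Smooth) : f.D.Smooth := by
  intro e
  have h := (hf e).derivWithin (m := ∞) (uniqueDiffOn_Icc (G.length_pos e)) (by simp)
  exact h.congr fun x hx => EdgeFun.onLine_val f.D e ⟨x, hx⟩

variable (G)

/-- The real `0`-forms: smooth on the closed edges, continuous, with Kirchhoff conditions. -/
def zeroForms : Submodule ℝ (G.EdgeFun ℝ) where
  carrier := {f | f.Smooth ∧ f.MatchesAtVertices ∧ ∀ w, f.D.outwardSum w = 0}
  zero_mem' := by
    refine ⟨fun e => contDiffOn_const, ⟨0, fun e => ⟨rfl, rfl⟩⟩, fun w => ?_⟩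
    have : (0 : G.EdgeFun ℝ).D = 0 := by
      simpa using EdgeFun.D_smul (0 : ℝ) (0 : G.EdgeFun ℝ)
    rw [this]
    simp [EdgeFun.outwardSum]
  add_mem' := by
    rintro f g ⟨hf, ⟨a, ha⟩, hf'⟩ ⟨hg, ⟨b, hb⟩, hg'⟩
    refine ⟨fun e => (hf e).add (hg e), ⟨a + b, fun e => ⟨?_, ?_⟩⟩, fun w => ?_⟩
    · simp [(ha e).1, (hb e).1]
    · simp [(ha e).2, (hb e).2]
    · have : (f + g).D = f.D + g.D := by
        funext e x
        exact EdgeFun.D_add_apply (hf.differentiableWithinAt e x) (hg.differentiableWithinAt e x)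
      rw [this, EdgeFun.outwardSum_add, hf', hg', add_zero]
  smul_mem' := by
    rintro c f ⟨hf, ⟨a, ha⟩, hf'⟩
    refine ⟨fun e => (hf e).const_smul c, ⟨c • a, fun e => ⟨?_, ?_⟩⟩, fun w => ?_⟩
    · simp [(ha e).1]
    · simp [(ha e).2]
    · rw [EdgeFun.D_smul, EdgeFun.outwardSum_smul, hf', smul_zero]

/-- The real `1`-forms: smooth on the closed edges, with the boundary condition at the vertices. -/
def oneForms : Submodule ℝ (G.EdgeFun ℝ) where
  carrier := {a | a.Smooth ∧ ∀ w, a.outwardSum w = 0}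
  zero_mem' := ⟨fun e => contDiffOn_const, fun w => by simp [EdgeFun.outwardSum]⟩
  add_mem' := by
    rintro f g ⟨hf, hf'⟩ ⟨hg, hg'⟩
    exact ⟨fun e => (hf e).add (hg e), fun w => by
      rw [EdgeFun.outwardSum_add, hf', hg', add_zero]⟩
  smul_mem' := by
    rintro c f ⟨hf, hf'⟩
    exact ⟨fun e => (hf e).const_smul c, fun w => by
      rw [EdgeFun.outwardSum_smul, hf', smul_zero]⟩

/-- The exterior derivative from real `0`-forms to real `1`-forms. -/
def d : G.zeroForms →ₗ[ℝ] G.oneForms where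
  toFun f := ⟨f.1.D, f.2.1.D, f.2.2.2⟩
  map_add' f g := Subtype.ext <| by
    funext e x
    exact EdgeFun.D_add_apply (f.2.1.differentiableWithinAt e x) (g.2.1.differentiableWithinAt e x)
  map_smul' c f := Subtype.ext <| EdgeFun.D_smul c f.1

/-- The de Rham cohomology `H¹_dR(G, ℝ)`: real `1`-forms modulo differentials of real `0`-forms. -/
abbrev H1dR : Type v := G.oneForms ⧸ LinearMap.range G.d

variable {G}

/-- The integral of a `1`-form over the edge `e`, from `init e` to `term e`. -/
def edgeIntegral (α : G.oneForms) (e : G.E) : ℝ :=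
  ∫ t in (0 : ℝ)..G.length e, α.1.onLine e t

theorem edgeIntegral_intervalIntegrable (α : G.oneForms) (e : G.E) :
    IntervalIntegrable (α.1.onLine e) volume 0 (G.length e) := by
  apply ContinuousOn.intervalIntegrable
  rw [Set.uIcc_of_le (G.length_pos e).le]
  exact (α.2.1 e).continuousOn

theorem edgeIntegral_add (α β : G.oneForms) (e : G.E) :
    edgeIntegral (α + β) e = edgeIntegral α e + edgeIntegral β e :=
  intervalIntegral.integral_add (edgeIntegral_intervalIntegrable α e)
    (edgeIntegral_intervalIntegrable β e)

theorem edgeIntegral_neg (α : G.oneForms) (e : G.E) :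
    edgeIntegral (-α) e = -edgeIntegral α e :=
  intervalIntegral.integral_neg

variable (G)

/-- The boundary map `C₁(G, ℤ) → C₀(G, ℤ)`, `e ↦ term e - init e`; its kernel is `H₁(G, ℤ)`. -/
def boundary : (G.E →₀ ℤ) →+ (G.V →₀ ℤ) :=
  Finsupp.liftAddHom fun e =>
    Finsupp.singleAddHom (G.term e) - Finsupp.singleAddHom (G.init e)

/-- The real `1`-forms with integral periods, that is, with integral pairing with every element of
`H₁(G, ℤ)`. -/
def integralForms : AddSubgroup G.oneForms where
  carrier := {α | ∀ c : G.E →₀ ℤ, G.boundary c = 0 →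
    ∃ n : ℤ, (c.sum fun e m => (m : ℝ) * edgeIntegral α e) = n}
  zero_mem' c _ := ⟨0, by
    have h (e : G.E) : edgeIntegral (0 : G.oneForms) e = 0 := by
      simpa using edgeIntegral_add (0 : G.oneForms) 0 e
    simp [h]⟩
  add_mem' := by
    intro α β hα hβ c hc
    obtain ⟨m, hm⟩ := hα c hc
    obtain ⟨n, hn⟩ := hβ c hc
    refine ⟨m + n, ?_⟩
    simp only [edgeIntegral_add, mul_add, Finsupp.sum_add, hm, hn, Int.cast_add]
  neg_mem' := by
    intro α hα c hc
    obtain ⟨m, hm⟩ := hα c hc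
    refine ⟨-m, ?_⟩
    simp only [edgeIntegral_neg, mul_neg, Finsupp.sum_neg, hm, Int.cast_neg]

/-- The lattice `H¹_dR(G, ℤ)` of the de Rham classes with integral periods. -/
def H1dRInt : AddSubgroup G.H1dR :=
  G.integralForms.map (LinearMap.range G.d).mkQ.toAddMonoidHom

/-- The torus `H¹_dR(G, ℝ) / H¹_dR(G, ℤ)`. -/
abbrev BlochTorus : Type v := G.H1dR ⧸ G.H1dRInt

variable {G}

/-- The point of the torus given by a real `1`-form. -/
def torusClass (α : G.oneForms) : G.BlochTorus :=
  QuotientAddGroup.mk (Submodule.Quotient.mk α)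

/-! ### Schrödinger operators and spectra -/

/-- The Sobolev space `W₂` of an edge, through weak derivatives: `f` has a first derivative `g`
that is absolutely continuous, and the derivative `h` of `g` is square integrable. -/
def MemW2 (L : ℝ) (f : Set.Icc (0 : ℝ) L → ℂ) : Prop :=
  ∃ g h : ℝ → ℂ, MemLp h 2 (volume.restrict (Set.Icc 0 L)) ∧
    (∀ x ∈ Set.Icc 0 L, g x = g 0 + ∫ t in (0 : ℝ)..x, h t) ∧
    ∀ x y : Set.Icc (0 : ℝ) L, f y = f x + ∫ t in (x : ℝ)..y, g t

theorem MemW2.zero (L : ℝ) : MemW2 L 0 :=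
  ⟨0, 0, MemLp.zero, by simp, by simp⟩

theorem memW2_intervalIntegrable {L : ℝ} {h : ℝ → ℂ}
    (hh : MemLp h 2 (volume.restrict (Set.Icc 0 L))) {x y : ℝ} (hx : x ∈ Set.Icc 0 L)
    (hy : y ∈ Set.Icc 0 L) : IntervalIntegrable h volume x y := by
  have : IntegrableOn h (Set.Icc 0 L) volume := hh.integrable (by norm_num)
  exact ((this.mono_set (Set.uIcc_subset_Icc hx hy))).intervalIntegrable

theorem memW2_continuousOn {L : ℝ} (hL : 0 < L) {g h : ℝ → ℂ}
    (hh : MemLp h 2 (volume.restrict (Set.Icc 0 L)))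
    (hg : ∀ x ∈ Set.Icc 0 L, g x = g 0 + ∫ t in (0 : ℝ)..x, h t) :
    ContinuousOn g (Set.Icc 0 L) := by
  have hi : IntegrableOn h (Set.Icc 0 L) volume := hh.integrable (by norm_num)
  have h1 := intervalIntegral.continuousOn_primitive_interval (a := 0) (b := L) (f := h)
    (μ := volume) (by rwa [Set.uIcc_of_le hL.le])
  rw [Set.uIcc_of_le hL.le] at h1
  exact (continuousOn_const.add h1).congr hg

theorem memW2_integrable_g {L : ℝ} (hL : 0 < L) {g h : ℝ → ℂ}
    (hh : MemLp h 2 (volume.restrict (Set.Icc 0 L)))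
    (hg : ∀ x ∈ Set.Icc 0 L, g x = g 0 + ∫ t in (0 : ℝ)..x, h t) {x y : ℝ}
    (hx : x ∈ Set.Icc 0 L) (hy : y ∈ Set.Icc 0 L) : IntervalIntegrable g volume x y :=
  ((memW2_continuousOn hL hh hg).mono (Set.uIcc_subset_Icc hx hy)).intervalIntegrable

theorem MemW2.add {L : ℝ} (hL : 0 < L) {f f' : Set.Icc (0 : ℝ) L → ℂ} (hf : MemW2 L f)
    (hf' : MemW2 L f') : MemW2 L (f + f') := by
  obtain ⟨g, h, hh, hg, hfg⟩ := hf
  obtain ⟨g', h', hh', hg', hfg'⟩ := hf'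
  refine ⟨g + g', h + h', hh.add hh', fun x hx => ?_, fun x y => ?_⟩
  · have h0 : (0 : ℝ) ∈ Set.Icc 0 L := ⟨le_rfl, hL.le⟩
    simp only [Pi.add_apply]
    rw [intervalIntegral.integral_add (memW2_intervalIntegrable hh h0 hx)
      (memW2_intervalIntegrable hh' h0 hx), hg x hx, hg' x hx]
    ring
  · simp only [Pi.add_apply]
    rw [intervalIntegral.integral_add (memW2_integrable_g hL hh hg x.2 y.2)
      (memW2_integrable_g hL hh' hg' x.2 y.2), hfg x y, hfg' x y]
    ring

theorem MemW2.smul {L : ℝ} {f : Set.Icc (0 : ℝ) L → ℂ} (c : ℂ) (hf : MemW2 L f) :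
    MemW2 L (c • f) := by
  obtain ⟨g, h, hh, hg, hfg⟩ := hf
  refine ⟨c • g, c • h, hh.const_smul c, fun x hx => ?_, fun x y => ?_⟩
  · simp only [Pi.smul_apply, intervalIntegral.integral_smul]
    rw [hg x hx, smul_add]
  · simp only [Pi.smul_apply, intervalIntegral.integral_smul]
    rw [hfg x y, smul_add]

/-- For a real `1`-form `α`, the operator `d_α f = f' + 2πi α f`. -/
def dTwist (α : G.oneForms) (f : G.EdgeFun ℂ) : G.EdgeFun ℂ :=
  fun e x => f.D e x + 2 * Real.pi * Complex.I * (α.1 e x : ℂ) * f e x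

/-- The formal adjoint `d_α^* β = -β' - 2πi α β` of `d_α`. -/
def dTwistAdjoint (α : G.oneForms) (β : G.EdgeFun ℂ) : G.EdgeFun ℂ :=
  fun e x => -β.D e x - 2 * Real.pi * Complex.I * (α.1 e x : ℂ) * β e x

/-- The Schrödinger type operator `Δ_α = d_α^* d_α`. -/
def schrodinger (α : G.oneForms) (f : G.EdgeFun ℂ) : G.EdgeFun ℂ :=
  dTwistAdjoint α (dTwist α f)

theorem dTwist_smul (α : G.oneForms) (c : ℂ) (f : G.EdgeFun ℂ) :
    dTwist α (c • f) = c • dTwist α f := by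
  funext e x
  simp only [dTwist, EdgeFun.D_smul, Pi.smul_apply, smul_eq_mul]
  ring

theorem schrodinger_smul (α : G.oneForms) (c : ℂ) (f : G.EdgeFun ℂ) :
    schrodinger α (c • f) = c • schrodinger α f := by
  funext e x
  simp only [schrodinger, dTwistAdjoint, dTwist_smul, EdgeFun.D_smul, Pi.smul_apply, smul_eq_mul]
  ring

theorem MemW2.differentiableWithinAt {f : G.EdgeFun ℂ} {e : G.E} (hf : MemW2 (G.length e) (f e)) :
    ∃ g : ℝ → ℂ, (∀ x ∈ Set.Icc 0 (G.length e),
        HasDerivWithinAt (f.onLine e) (g x) (Set.Icc 0 (G.length e)) x) ∧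
      ∀ᵐ x, x ∈ Set.Icc 0 (G.length e) → DifferentiableAt ℝ g x := by
  obtain ⟨g, h, hh, hg, hfg⟩ := hf
  have hL := G.length_pos e
  have hgc := memW2_continuousOn hL hh hg
  have h0 : (0 : ℝ) ∈ Set.Icc 0 (G.length e) := ⟨le_rfl, hL.le⟩
  have h1 : G.length e ∈ Set.Icc 0 (G.length e) := ⟨hL.le, le_rfl⟩
  refine ⟨g, fun x hx => ?_, ?_⟩
  · set g' : ℝ → ℂ := Set.IccExtend hL.le (Set.domRestrict (Set.Icc 0 (G.length e)) g) with hg'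
    have hc : Continuous g' := continuous_IccExtend_iff.2 hgc.domRestrict
    have he : ∀ t ∈ Set.Icc 0 (G.length e), g' t = g t := fun t ht =>
      Set.IccExtend_of_mem hL.le _ ht
    have hd : HasDerivAt (fun y => f e (G.start e) + ∫ t in (0 : ℝ)..y, g' t) (g' x) x :=
      (hc.integral_hasStrictDerivAt 0 x).hasDerivAt.const_add _
    rw [he x hx] at hd
    refine hd.hasDerivWithinAt.congr_of_mem (fun y hy => ?_) hx
    have := f.onLine_val e ⟨y, hy⟩
    simp only at this
    rw [this, hfg (G.start e) ⟨y, hy⟩]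
    congr 1
    refine intervalIntegral.integral_congr fun t ht => (he t ?_).symm
    exact Set.uIcc_subset_Icc h0 hy ht
  · have hi := (memW2_intervalIntegrable hh h0 h1).ae_hasDerivAt_integral
    have n0 : ∀ᵐ x : ℝ, x ≠ 0 := by simp [ae_iff]
    have n1 : ∀ᵐ x : ℝ, x ≠ G.length e := by simp [ae_iff]
    filter_upwards [hi, n0, n1] with x hx hx0 hx1 hmem
    rw [Set.uIcc_of_le hL.le] at hx
    have hd := (hx hmem 0 h0).const_add (g 0)
    refine (hd.congr_of_eventuallyEq ?_).differentiableAt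
    filter_upwards [Icc_mem_nhds (lt_of_le_of_ne hmem.1 (Ne.symm hx0))
      (lt_of_le_of_ne hmem.2 hx1)] with y hy using hg y hy

variable (G)

/-- The common domain of the operators `Δ_α`: functions that are `W₂` on the edges, continuous at
the vertices, and satisfy the Kirchhoff condition. -/
def domain : Submodule ℂ (G.EdgeFun ℂ) where
  carrier := {f | (∀ e, MemW2 (G.length e) (f e)) ∧ f.MatchesAtVertices ∧
    ∀ w, f.D.outwardSum w = 0}
  zero_mem' := by
    refine ⟨fun e => MemW2.zero _, ⟨0, fun e => ⟨rfl, rfl⟩⟩, fun w => ?_⟩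
    have : (0 : G.EdgeFun ℂ).D = 0 := by
      simpa using EdgeFun.D_smul (0 : ℂ) (0 : G.EdgeFun ℂ)
    rw [this]
    simp [EdgeFun.outwardSum]
  add_mem' := by
    rintro f g ⟨hf, ⟨a, ha⟩, hf'⟩ ⟨hg, ⟨b, hb⟩, hg'⟩
    refine ⟨fun e => (hf e).add (G.length_pos e) (hg e), ⟨a + b, fun e => ⟨?_, ?_⟩⟩, fun w => ?_⟩
    · simp [(ha e).1, (hb e).1]
    · simp [(ha e).2, (hb e).2]
    · have : (f + g).D = f.D + g.D := by
        funext e x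
        obtain ⟨u, hu, -⟩ := (hf e).differentiableWithinAt
        obtain ⟨v, hv, -⟩ := (hg e).differentiableWithinAt
        exact EdgeFun.D_add_apply (hu x x.2).differentiableWithinAt
          (hv x x.2).differentiableWithinAt
      rw [this, EdgeFun.outwardSum_add, hf', hg', add_zero]
  smul_mem' := by
    rintro c f ⟨hf, ⟨a, ha⟩, hf'⟩
    refine ⟨fun e => (hf e).smul c, ⟨c • a, fun e => ⟨?_, ?_⟩⟩, fun w => ?_⟩
    · simp [(ha e).1]
    · simp [(ha e).2]
    · rw [EdgeFun.D_smul, EdgeFun.outwardSum_smul, hf', smul_zero]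

variable {G}

theorem dTwist_add {α : G.oneForms} {f g : G.EdgeFun ℂ} {e : G.E}
    (hf : MemW2 (G.length e) (f e)) (hg : MemW2 (G.length e) (g e)) (x : G.Seg e) :
    dTwist α (f + g) e x = dTwist α f e x + dTwist α g e x := by
  obtain ⟨u, hu, -⟩ := hf.differentiableWithinAt
  obtain ⟨v, hv, -⟩ := hg.differentiableWithinAt
  simp only [dTwist, Pi.add_apply]
  rw [EdgeFun.D_add_apply (hu x x.2).differentiableWithinAt (hv x x.2).differentiableWithinAt]
  ring

theorem dTwist_differentiable (α : G.oneForms) {f : G.EdgeFun ℂ} {e : G.E}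
    (hf : MemW2 (G.length e) (f e)) :
    ∀ᵐ (x : G.Seg e) ∂(G.segMeasure e), DifferentiableWithinAt ℝ
      ((dTwist α f).onLine e)
      (Set.Icc 0 (G.length e)) x := by
  obtain ⟨u, hu, hu'⟩ := hf.differentiableWithinAt
  have hu'' : ∀ᵐ (x : G.Seg e) ∂(G.segMeasure e), DifferentiableAt ℝ u x :=
    (ae_restrict_iff_subtype (μ := volume) (p := fun x => DifferentiableAt ℝ u x)
      measurableSet_Icc).1 ((ae_restrict_iff' measurableSet_Icc).2 hu')
  filter_upwards [hu''] with x hx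
  have hα : DifferentiableWithinAt ℝ (fun t => (α.1.onLine e t : ℂ)) (Set.Icc 0 (G.length e)) x :=
    Complex.ofRealCLM.differentiableAt.comp_differentiableWithinAt _
      (α.2.1.differentiableWithinAt e x)
  have h := hx.differentiableWithinAt (s := Set.Icc 0 (G.length e)) |>.add
    ((hα.const_mul (2 * Real.pi * Complex.I)).mul (hu x x.2).differentiableWithinAt)
  suffices H : ∀ y ∈ Set.Icc 0 (G.length e), (dTwist α f).onLine e y =
      (u + (fun y => 2 * Real.pi * Complex.I * (α.1.onLine e y : ℂ)) * f.onLine e) y from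
    h.congr H (H x x.2)
  intro y hy
  have h1 := (dTwist α f).onLine_val e ⟨y, hy⟩
  have h2 := α.1.onLine_val e ⟨y, hy⟩
  have h3 := f.onLine_val e ⟨y, hy⟩
  have h4 : f.D e ⟨y, hy⟩ = u y :=
    (hu y hy).derivWithin (EdgeFun.uniqueDiffWithinAt e ⟨y, hy⟩)
  simp only at h1 h2 h3
  simp only [h1, h2, h3, dTwist, h4, Pi.add_apply, Pi.mul_apply]

theorem schrodinger_add {α : G.oneForms} {f g : G.EdgeFun ℂ} {e : G.E}
    (hf : ∀ e, MemW2 (G.length e) (f e)) (hg : ∀ e, MemW2 (G.length e) (g e)) :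
    ∀ᵐ (x : G.Seg e) ∂(G.segMeasure e), schrodinger α (f + g) e x = schrodinger α f e x + schrodinger α g e x := by
  have h : dTwist α (f + g) = dTwist α f + dTwist α g := by
    funext e x
    exact dTwist_add (hf e) (hg e) x
  filter_upwards [dTwist_differentiable α (hf e), dTwist_differentiable α (hg e)] with x hx hx'
  simp only [schrodinger, h, dTwistAdjoint, EdgeFun.D_add_apply hx hx', Pi.add_apply]
  ring

/-- The solutions of `Δ_α f = z f` in the domain of `Δ_α`.  Both sides are elements of `L²`, so
that the equation is required almost everywhere. -/
def eigenspace (α : G.oneForms) (z : ℂ) : Submodule ℂ (G.EdgeFun ℂ) where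
  carrier := {f | f ∈ G.domain ∧ ∀ e, ∀ᵐ (x : G.Seg e) ∂(G.segMeasure e), schrodinger α f e x = z * f e x}
  zero_mem' := by
    refine ⟨G.domain.zero_mem, fun e => Filter.Eventually.of_forall fun x => ?_⟩
    have : schrodinger α 0 = 0 := by simpa using schrodinger_smul α 0 0
    simp [this]
  add_mem' := by
    rintro f g ⟨hf, hf'⟩ ⟨hg, hg'⟩
    refine ⟨G.domain.add_mem hf hg, fun e => ?_⟩
    filter_upwards [schrodinger_add hf.1 hg.1, hf' e, hg' e] with x h1 h2 h3
    rw [h1, h2, h3, Pi.add_apply, Pi.add_apply, mul_add]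
  smul_mem' := by
    rintro c f ⟨hf, hf'⟩
    refine ⟨G.domain.smul_mem c hf, fun e => ?_⟩
    filter_upwards [hf' e] with x h
    simp only [schrodinger_smul, Pi.smul_apply, smul_eq_mul, h]
    ring

/-- The spectrum `Spec_α(G)`, the set of eigenvalues including multiplicities: the function that
assigns to each complex number its multiplicity as an eigenvalue of `Δ_α`. -/
def spec (α : G.oneForms) (z : ℂ) : ℕ∞ :=
  Cardinal.toENat (Module.rank ℂ (eigenspace α z))

/-! ### Fundamental group and universal cover -/

variable (G)

/-- The edges from `a` to `b`. -/
instance quiver : Quiver.{v} G.V where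
  Hom a b := {e : G.E // G.init e = a ∧ G.term e = b}

/-- The homotopy classes of paths in the graph from `a` to `b`: alternating sequences of vertices
and edges, each edge passed in one of its two directions, up to insertion and deletion of
backtracks. -/
abbrev PathClass (a b : G.V) : Type (max u v) :=
  (Quiver.FreeGroupoid.of G.V).obj a ⟶ (Quiver.FreeGroupoid.of G.V).obj b

/-- The fundamental group `π₁(G, v₀)`: homotopy classes of closed paths at `v₀`, with
concatenation. -/
abbrev FundGroup (v₀ : G.V) : Type (max u v) := G.PathClass v₀ v₀

variable {G}

/-- The class of the path that passes the edge `e` once in its direction. -/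
def edgePath (e : G.E) : G.PathClass (G.init e) (G.term e) :=
  (Quiver.FreeGroupoid.of G.V).map (⟨e, rfl, rfl⟩ : G.init e ⟶ G.term e)

/-- The functor on path classes whose value on each edge `e` is `∫_e α`. -/
def integralFunctor (α : G.oneForms) :
    Quiver.FreeGroupoid G.V ⥤ SingleObj (Multiplicative ℝ) :=
  Quiver.FreeGroupoid.lift
    { obj := fun _ => SingleObj.star _
      map := fun e => (Multiplicative.ofAdd (edgeIntegral α e.1) : Multiplicative ℝ) }

/-- The integral `∫_γ α` of a `1`-form over a path: the sum of the integrals over the edges of the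
path, with a minus sign where an edge is passed against its direction. -/
def pathIntegral (α : G.oneForms) {a b : G.V} (γ : G.PathClass a b) : ℝ :=
  Multiplicative.toAdd (show Multiplicative ℝ from (integralFunctor α).map γ)

theorem pathIntegral_edgePath (α : G.oneForms) (e : G.E) :
    pathIntegral α (edgePath e) = edgeIntegral α e := by
  have h := Quiver.FreeGroupoid.lift_spec (V := G.V) (V' := SingleObj (Multiplicative ℝ))
    { obj := fun _ => SingleObj.star _
      map := fun e => (Multiplicative.ofAdd (edgeIntegral α e.1) : Multiplicative ℝ) }
  have h2 := Prefunctor.congr_hom h (⟨e, rfl, rfl⟩ : G.init e ⟶ G.term e)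
  exact congrArg Multiplicative.toAdd h2

theorem pathIntegral_comp (α : G.oneForms) {a b c : G.V} (γ : G.PathClass a b)
    (δ : G.PathClass b c) :
    pathIntegral α (γ ≫ δ : G.PathClass a c) = pathIntegral α γ + pathIntegral α δ := by
  have h := (integralFunctor α).map_comp γ δ
  rw [SingleObj.comp_as_mul] at h
  exact (congrArg Multiplicative.toAdd h).trans (add_comm _ _)

variable (G)

/-- The universal cover of `G`, a metric tree.  Its vertices over `w` are the homotopy classes of
paths from `v₀` to `w`; the lift of the edge `e` starting at the class `p` of a path from `v₀` to
`init e` ends at the class of `p` followed by `e`, and has the length of `e`. -/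
def universalCover (v₀ : G.V) : MetricGraph.{max u v, max u v} where
  V := Σ w : G.V, G.PathClass v₀ w
  E := Σ e : G.E, G.PathClass v₀ (G.init e)
  init e := ⟨G.init e.1, e.2⟩
  term e := ⟨G.term e.1, e.2 ≫ edgePath e.1⟩
  length e := G.length e.1
  length_pos e := G.length_pos e.1
  finite_init w := by
    refine Set.Finite.of_injOn (f := Sigma.fst) ?_ ?_ (G.finite_init w.1)
    · rintro e rfl
      rfl
    · rintro ⟨e, p⟩ he ⟨e', p'⟩ he' (rfl : e = e')
      have h := he.trans he'.symm
      simpa using h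
  finite_term w := by
    refine Set.Finite.of_injOn (f := Sigma.fst) ?_ ?_ (G.finite_term w.1)
    · rintro e rfl
      rfl
    · rintro ⟨e, p⟩ he ⟨e', p'⟩ he' (rfl : e = e')
      have h := he.trans he'.symm
      simp only [Sigma.mk.injEq, heq_eq_eq, true_and] at h
      rw [(cancel_mono _).1 h]

/-- The action of the fundamental group by deck transformations on the vertices. -/
instance deckVertices (v₀ : G.V) : MulAction (G.FundGroup v₀) (G.universalCover v₀).V where
  smul γ w := ⟨w.1, γ ≫ w.2⟩
  one_smul w := Sigma.ext rfl (heq_of_eq (Category.id_comp w.2))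
  mul_smul γ δ w := Sigma.ext rfl (heq_of_eq (Category.assoc γ δ w.2))

/-- The action of the fundamental group by deck transformations on the edges; the point of an edge
with parameter `x` is sent to the point of the image edge with the same parameter. -/
instance deckEdges (v₀ : G.V) : MulAction (G.FundGroup v₀) (G.universalCover v₀).E where
  smul γ e := ⟨e.1, γ ≫ e.2⟩
  one_smul e := Sigma.ext rfl (heq_of_eq (Category.id_comp e.2))
  mul_smul γ δ e := Sigma.ext rfl (heq_of_eq (Category.assoc γ δ e.2))

theorem deck_init (v₀ : G.V) (γ : G.FundGroup v₀) (e : (G.universalCover v₀).E) :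
    (G.universalCover v₀).init (γ • e) = γ • (G.universalCover v₀).init e := rfl

theorem deck_term (v₀ : G.V) (γ : G.FundGroup v₀) (e : (G.universalCover v₀).E) :
    (G.universalCover v₀).term (γ • e) = γ • (G.universalCover v₀).term e :=
  Sigma.ext rfl (heq_of_eq (Category.assoc γ e.2 _))

theorem deck_length (v₀ : G.V) (γ : G.FundGroup v₀) (e : (G.universalCover v₀).E) :
    (G.universalCover v₀).length (γ • e) = (G.universalCover v₀).length e := rfl

variable {G}

/-- The functions on the universal cover with `f (γ x) = χ(γ) f x`. -/
def equivariant {v₀ : G.V} (χ : G.FundGroup v₀ →* Circle) :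
    Submodule ℂ ((G.universalCover v₀).EdgeFun ℂ) where
  carrier := {f | ∀ (γ : G.FundGroup v₀) (e : (G.universalCover v₀).E)
    (x : (G.universalCover v₀).Seg e), f (γ • e) x = (χ γ : ℂ) * f e x}
  zero_mem' _ _ _ := (mul_zero _).symm
  add_mem' hf hg γ e x := by
    have h : ∀ a b : ℂ, (χ γ : ℂ) * (a + b) = (χ γ : ℂ) * a + (χ γ : ℂ) * b := mul_add _
    exact (congrArg₂ (· + ·) (hf γ e x) (hg γ e x)).trans (h _ _).symm
  smul_mem' c f hf γ e x :=
    (congrArg (c * ·) (hf γ e x)).trans (mul_left_comm c (χ γ : ℂ) (f e x))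

/-- The spectrum `Spec(G, χ)`: the eigenvalues, with multiplicities, of the standard Laplacian
`d^* d` (that is, `Δ_α` with `α = 0`) of the universal cover on the `χ`-equivariant functions that
are continuous and satisfy the Kirchhoff conditions. -/
def piOneSpec {v₀ : G.V} (χ : G.FundGroup v₀ →* Circle) (z : ℂ) : ℕ∞ :=
  Cardinal.toENat (Module.rank ℂ
    ↥(eigenspace (0 : (G.universalCover v₀).oneForms) z ⊓ equivariant χ))

end

end MetricGraph

namespace MetricGraph

variable {G : MetricGraph.{u, v}}

/-! ### Path classes -/

/-! On the universal cover put φ(x) = exp(-2πi ∫_{v₀}^x α) (`gauge`). This is well defined because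
the integral of α depends only on the path class, and it satisfies φ' = -2πi α φ and φ(γx) = χ_α(γ)
φ(x). Since φ never vanishes, f ↦ φ·f (`gaugeLift`) identifies the functions on G with the
χ_α-equivariant functions on the cover (`range_gaugeLift`). From (φf)' = φ·d_{-α}f it follows that
Δ_{-α} becomes the standard Laplacian. The vertex conditions correspond because φ is continuous on
the cover and the vertex condition on α removes the extra term 2πi α f from the Kirchhoff sum. Thus
Spec(G, χ_α) = Spec_{-α}(G) (`gaugeLift_mem_eigenspace_iff`).

The remaining sign is removed by conjugation: it carries the z-eigenspace of Δ_{-α} to the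
z̄-eigenspace of Δ_α, and on a finite graph all eigenvalues are real (`spec_neg`).

To avoid almost-everywhere arguments on the cover, the eigenvalue equation is first rewritten as a
pointwise first order system for the pair (f, d_α f) (`mem_eigenspace_iff`). The gauge
transformation then needs only the product rule.

For the bijection, χ_α = χ_β means that α - β has integral integrals over all closed paths,
equivalently over all cycles (`integralForms_iff`), which is equality in the torus
(`character_eq_iff`). Every character occurs because the edge integrals of a form can be prescribed
freely (`character_surjective`). That Spec_α depends only on the class of α then comes for free,
since it is determined by χ_α. -/

/-- Induction on path classes with a fixed initial vertex. -/
theorem PathClass.induction {a : G.V} {P : ∀ b : G.V, G.PathClass a b → Prop}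
    (id : P a (𝟙 _))
    (edge : ∀ (e : G.E) (p : G.PathClass a (G.init e)), P _ p → P _ (p ≫ edgePath e))
    (edge_inv : ∀ (e : G.E) (p : G.PathClass a (G.term e)), P _ p →
      P _ (p ≫ Groupoid.inv (edgePath e)))
    {b : G.V} (p : G.PathClass a b) : P b p := by
  -- A morphism of the free groupoid is the class of a word in edges and reversed edges, so the
  -- induction runs over the last letter of the word.
  obtain ⟨q, rfl⟩ : ∃ q : @Quiver.Path (Quiver.Symmetrify G.V) _ a b, p = Quot.mk _ q := by
    induction p using Quot.inductionOn with
    | h q => exact ⟨q, rfl⟩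
  induction q with
  | nil => exact id
  | cons q f ih =>
    rcases f with ⟨e, rfl, rfl⟩ | ⟨e, rfl, rfl⟩
    · exact edge e _ ih
    · exact edge_inv e _ ih

theorem Connected.exists_pathClass (hG : G.Connected) (a b : G.V) : Nonempty (G.PathClass a b) := by
  induction hG a b with
  | refl => exact ⟨𝟙 _⟩
  | tail _ h ih =>
    obtain ⟨p⟩ := ih
    obtain ⟨e, ⟨rfl, rfl⟩ | ⟨rfl, rfl⟩⟩ := h
    · exact ⟨p ≫ edgePath e⟩
    · exact ⟨p ≫ Groupoid.inv (edgePath e)⟩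

theorem pathIntegral_id (α : G.oneForms) (a : G.V) :
    pathIntegral α (𝟙 _ : G.PathClass a a) = 0 := by
  have h := pathIntegral_comp α (𝟙 _ : G.PathClass a a) (𝟙 _ : G.PathClass a a)
  rw [Category.id_comp] at h
  linarith

theorem pathIntegral_inv (α : G.oneForms) {a b : G.V} (p : G.PathClass a b) :
    pathIntegral α (Groupoid.inv p : G.PathClass b a) = -pathIntegral α p := by
  have h := pathIntegral_comp α p (Groupoid.inv p : G.PathClass b a)
  rw [Groupoid.comp_inv, pathIntegral_id] at h
  linarith

theorem pathIntegral_add (α β : G.oneForms) {a b : G.V} (p : G.PathClass a b) :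
    pathIntegral (α + β) p = pathIntegral α p + pathIntegral β p := by
  induction p using PathClass.induction with
  | id => simp [pathIntegral_id]
  | edge e p ih => rw [pathIntegral_comp, pathIntegral_comp, pathIntegral_comp, ih,
      pathIntegral_edgePath, pathIntegral_edgePath, pathIntegral_edgePath, edgeIntegral_add]; ring
  | edge_inv e p ih => rw [pathIntegral_comp, pathIntegral_comp, pathIntegral_comp, ih,
      pathIntegral_inv, pathIntegral_inv, pathIntegral_inv,
      pathIntegral_edgePath, pathIntegral_edgePath, pathIntegral_edgePath, edgeIntegral_add]; ring

/-- Every path is homologous to a chain that has the same integrals. -/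
theorem exists_chain {a b : G.V} (p : G.PathClass a b) :
    ∃ c : G.E →₀ ℤ, G.boundary c = Finsupp.single b 1 - Finsupp.single a 1 ∧
      ∀ α : G.oneForms, (c.sum fun e m => (m : ℝ) * edgeIntegral α e) = pathIntegral α p := by
  have hb (e : G.E) : G.boundary (Finsupp.single e 1) =
      Finsupp.single (G.term e) 1 - Finsupp.single (G.init e) 1 := by
    simp [boundary]
  induction p using PathClass.induction with
  | id => exact ⟨0, by simp, fun α => by simp [pathIntegral_id]⟩
  | edge e p ih =>
    obtain ⟨c, hc, hc'⟩ := ih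
    refine ⟨c + Finsupp.single e 1, by rw [map_add, hc, hb]; abel, fun α => ?_⟩
    rw [Finsupp.sum_add_index' (by simp) (by intros; push_cast; ring), hc', pathIntegral_comp,
      pathIntegral_edgePath]
    simp
  | edge_inv e p ih =>
    obtain ⟨c, hc, hc'⟩ := ih
    refine ⟨c + Finsupp.single e (-1), ?_, fun α => ?_⟩
    · rw [map_add, hc, Finsupp.single_neg, map_neg, hb]; abel
    · rw [Finsupp.sum_add_index' (by simp) (by intros; push_cast; ring), hc', pathIntegral_comp,
        pathIntegral_inv, pathIntegral_edgePath, Finsupp.sum_single_index (by simp)]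
      simp

/-- The pairing of a chain with the coboundary of a function on the vertices. -/
theorem sum_coboundary (F : G.V → ℝ) (c : G.E →₀ ℤ) :
    (c.sum fun e m => (m : ℝ) * (F (G.term e) - F (G.init e))) =
      (G.boundary c).sum fun w m => (m : ℝ) * F w := by
  induction c using Finsupp.induction_linear with
  | zero => simp
  | add c d hc hd =>
    rw [Finsupp.sum_add_index' (by simp) (by intros; push_cast; ring), hc, hd, map_add,
      Finsupp.sum_add_index' (by simp) (by intros; push_cast; ring)]
  | single e m =>
    have : G.boundary (Finsupp.single e m) =
        Finsupp.single (G.term e) m + Finsupp.single (G.init e) (-m) := by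
      simp [boundary, sub_eq_add_neg]
    rw [this, Finsupp.sum_add_index' (by simp) (by intros; push_cast; ring),
      Finsupp.sum_single_index (by simp), Finsupp.sum_single_index (by simp),
      Finsupp.sum_single_index (by simp)]
    push_cast
    ring

/-! ### Integral periods and equality in the torus -/

/-- A closed path gives a cycle with the same integrals. Conversely, after joining `v₀` to every
vertex w by a path p_w, a cycle Σ c_e e has the same integral as the combination with coefficients
c_e of the closed paths p_{init e} · e · p_{term e}⁻¹: the contributions of the p_w cancel because
the boundary vanishes. -/
theorem integralForms_iff (hG : G.Connected) (v₀ : G.V) (α : G.oneForms) :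
    α ∈ G.integralForms ↔ ∀ γ : G.FundGroup v₀, ∃ n : ℤ, pathIntegral α γ = n := by
  constructor
  · intro h γ
    obtain ⟨c, hc, hc'⟩ := exists_chain γ
    rw [sub_self] at hc
    obtain ⟨n, hn⟩ := h c hc
    exact ⟨n, by rw [← hc', hn]⟩
  · intro h c hc
    obtain ⟨p⟩ : Nonempty (∀ w, G.PathClass v₀ w) := ⟨fun w => (hG.exists_pathClass v₀ w).some⟩
    choose n hn using fun e => h ((p (G.init e) ≫ edgePath e) ≫ Groupoid.inv (p (G.term e)))
    refine ⟨c.sum fun e m => m * n e, ?_⟩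
    -- The total contribution of the connecting paths is the pairing of the cycle with a coboundary,
    -- hence zero.
    have h0 := sum_coboundary (fun w => -pathIntegral α (p w)) c
    rw [hc, Finsupp.sum_zero_index] at h0
    rw [← add_zero (c.sum _), ← h0, ← Finsupp.sum_add, Finsupp.sum, Finsupp.sum]
    push_cast
    refine Finset.sum_congr rfl fun e _ => ?_
    rw [← mul_add]
    have := hn e
    simp only [pathIntegral_comp, pathIntegral_inv, pathIntegral_edgePath] at this
    rw [← this]
    ring

theorem edgeIntegral_d (f : G.zeroForms) (e : G.E) :
    edgeIntegral (G.d f) e = f.1 e (G.finish e) - f.1 e (G.start e) := by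
  have hL := (G.length_pos e).le
  have hd (x : ℝ) (hx : x ∈ Set.Icc 0 (G.length e)) : HasDerivWithinAt (f.1.onLine e)
      ((G.d f).1.onLine e x) (Set.Icc 0 (G.length e)) x := by
    have h := (f.2.1.differentiableWithinAt e ⟨x, hx⟩).hasDerivWithinAt
    have h2 := (G.d f).1.onLine_val e ⟨x, hx⟩
    simp only at h2
    rw [h2]
    exact h
  rw [edgeIntegral, intervalIntegral.integral_eq_sub_of_hasDerivAt_of_le hL
    (fun x hx => (hd x hx).continuousWithinAt)
    (fun x hx => (hd x (Set.Ioo_subset_Icc_self hx)).hasDerivAt (Icc_mem_nhds hx.1 hx.2))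
    (edgeIntegral_intervalIntegrable _ e)]
  exact congrArg₂ (· - ·) (f.1.onLine_val e (G.finish e)) (f.1.onLine_val e (G.start e))

theorem d_mem_integralForms (f : G.zeroForms) : G.d f ∈ G.integralForms := by
  intro c hc
  obtain ⟨F, hF⟩ := f.2.2.1
  refine ⟨0, ?_⟩
  simp only [edgeIntegral_d, (hF _).1, (hF _).2]
  rw [sum_coboundary, hc, Finsupp.sum_zero_index, Int.cast_zero]

/-- Exact forms have zero periods on cycles, so integrality of one representative of a class is
integrality of all of them. -/
theorem torusClass_eq_iff (α β : G.oneForms) :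
    torusClass α = torusClass β ↔ α - β ∈ G.integralForms := by
  rw [torusClass, torusClass, QuotientAddGroup.eq, H1dRInt, AddSubgroup.mem_map]
  constructor
  · rintro ⟨δ, hδ, h⟩
    have h' : (Submodule.Quotient.mk δ : G.H1dR) = Submodule.Quotient.mk (-α + β) := h
    rw [Submodule.Quotient.eq] at h'
    obtain ⟨f, hf⟩ := h'
    have : α - β = G.d f - δ := by rw [hf]; abel
    rw [this]
    exact sub_mem (d_mem_integralForms f) hδ
  · intro h
    refine ⟨-(α - β), neg_mem h, ?_⟩
    change (Submodule.Quotient.mk (-(α - β)) : G.H1dR) = Submodule.Quotient.mk (-α + β)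
    congr 1
    abel

/-! ### The character of a form -/

/-- The phase `e^{-2πi t}`. -/
noncomputable def phase (t : ℝ) : Circle := Circle.exp (-2 * Real.pi * t)

theorem coe_phase (t : ℝ) :
    (phase t : ℂ) = Complex.exp (-2 * Real.pi * Complex.I * (t : ℂ)) := by
  rw [phase, Circle.coe_exp]
  congr 1
  push_cast
  ring

theorem phase_add (s t : ℝ) : phase (s + t) = phase s * phase t := by
  rw [phase, mul_add, Circle.exp_add]; rfl

theorem phase_zero : phase 0 = 1 := by simp [phase]

theorem phase_neg (t : ℝ) : phase (-t) = (phase t)⁻¹ := by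
  rw [eq_inv_iff_mul_eq_one, ← phase_add, neg_add_cancel, phase_zero]

theorem phase_eq_one_iff (t : ℝ) : phase t = 1 ↔ ∃ n : ℤ, t = n := by
  rw [phase, Circle.exp_eq_one]
  have := Real.pi_ne_zero
  constructor
  · rintro ⟨n, hn⟩
    refine ⟨-n, ?_⟩
    push_cast
    have : 2 * Real.pi * (t + n) = 0 := by linarith
    have := (mul_eq_zero.1 this).resolve_left (by positivity)
    linarith
  · rintro ⟨n, rfl⟩
    exact ⟨-n, by push_cast; ring⟩

theorem phase_surjective : Function.Surjective phase := by
  intro z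
  obtain ⟨t, rfl⟩ := Circle.exp_surjective z
  refine ⟨-t / (2 * Real.pi), ?_⟩
  rw [phase]
  congr 1
  field_simp

/-- The character `χ_α`. -/
noncomputable def character (v₀ : G.V) (α : G.oneForms) : G.FundGroup v₀ →* Circle where
  toFun γ := phase (pathIntegral α γ)
  map_one' := by
    rw [← phase_zero]
    exact congrArg phase (pathIntegral_id α v₀)
  map_mul' γ δ := by
    rw [← phase_add]
    exact congrArg phase (pathIntegral_comp α γ δ)

theorem character_apply (v₀ : G.V) (α : G.oneForms) (γ : G.FundGroup v₀) :
    character v₀ α γ = phase (pathIntegral α γ) := rfl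

/-- The quotient χ_α / χ_β is χ_{α-β}, and a phase is trivial exactly at the integers. This gives
both well-definedness and injectivity on the torus. -/
theorem character_eq_iff (hG : G.Connected) (v₀ : G.V) (α β : G.oneForms) :
    character v₀ α = character v₀ β ↔ torusClass α = torusClass β := by
  rw [torusClass_eq_iff, integralForms_iff hG v₀, DFunLike.ext_iff]
  refine forall_congr' fun γ => ?_
  rw [← phase_eq_one_iff, character_apply, character_apply]
  have h := pathIntegral_add (α - β) β γ
  rw [sub_add_cancel] at h
  rw [h, phase_add, mul_eq_right]

/-- There are `1`-forms with arbitrary integrals over the edges. -/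
theorem exists_edgeIntegral_eq (θ : G.E → ℝ) : ∃ α : G.oneForms, ∀ e, edgeIntegral α e = θ e := by
  -- A parabola that vanishes at both ends, so that the vertex condition is trivial; the factor
  -- comes from ∫₀ᴸ x(L - x) dx = L³/6.
  let a (e : G.E) (x : ℝ) : ℝ := 6 * θ e / G.length e ^ 3 * (x * (G.length e - x))
  have ha (e : G.E) : Set.EqOn (EdgeFun.onLine (G := G) (fun e x => a e x) e) (a e)
      (Set.Icc 0 (G.length e)) := fun x hx => EdgeFun.onLine_val _ e ⟨x, hx⟩
  refine ⟨⟨fun e x => a e x, fun e => ?_, fun w => ?_⟩, fun e => ?_⟩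
  · refine ContDiffOn.congr (f := a e) (ContDiff.contDiffOn ?_) (ha e)
    fun_prop
  · simp [EdgeFun.outwardSum, a, start, finish]
  · have hL := G.length_pos e
    change ∫ x in (0 : ℝ)..G.length e, EdgeFun.onLine (G := G) (fun e x => a e x) e x = θ e
    rw [intervalIntegral.integral_congr (g := a e) (by rw [Set.uIcc_of_le hL.le]; exact ha e)]
    simp only [a]
    rw [intervalIntegral.integral_const_mul]
    simp only [mul_sub]
    rw [intervalIntegral.integral_sub (Continuous.intervalIntegrable (by fun_prop) _ _)
        (Continuous.intervalIntegrable (by fun_prop) _ _),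
      intervalIntegral.integral_mul_const, integral_id]
    have : (fun x : ℝ => x * x) = fun x => x ^ 2 := by ext; ring
    rw [this, integral_pow]
    field_simp
    ring

/-- With connecting paths p_w from `v₀`, the edge e determines the closed path p_{init e} · e ·
p_{term e}⁻¹. A form whose integral over e is a logarithm of the value of χ on this closed path has
character χ. -/
theorem character_surjective (hG : G.Connected) (v₀ : G.V) :
    Function.Surjective (character (G := G) v₀) := by
  intro χ
  obtain ⟨p⟩ : Nonempty (∀ w, G.PathClass v₀ w) := ⟨fun w => (hG.exists_pathClass v₀ w).some⟩
  choose θ hθ using fun e => phase_surjective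
    (χ ((p (G.init e) ≫ edgePath e) ≫ Groupoid.inv (p (G.term e))))
  obtain ⟨α, hα⟩ := exists_edgeIntegral_eq θ
  have hmul (γ δ : G.FundGroup v₀) : χ (γ ≫ δ) = χ γ * χ δ := χ.map_mul γ δ
  -- The chosen path `p v₀` need not be trivial; the factor χ(p v₀) normalizes the right side to 1
  -- at the trivial path.
  have key {b : G.V} (q : G.PathClass v₀ b) :
      phase (pathIntegral α q) = χ (p v₀) * χ (q ≫ Groupoid.inv (p b)) := by
    induction q using PathClass.induction with
    | id =>
      rw [← hmul, pathIntegral_id, phase_zero, Category.id_comp, Groupoid.comp_inv]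
      exact χ.map_one.symm
    | edge e q ih =>
      rw [pathIntegral_comp, phase_add, ih, pathIntegral_edgePath, hα, hθ, mul_assoc, ← hmul]
      simp
    | edge_inv e q ih =>
      rw [pathIntegral_comp, phase_add, ih, pathIntegral_inv, phase_neg, pathIntegral_edgePath, hα,
        hθ, mul_inv_eq_iff_eq_mul]
      conv_rhs => rw [mul_assoc, ← hmul]
      simp
  refine ⟨α, MonoidHom.ext fun γ => ?_⟩
  rw [character_apply, key, ← hmul]
  have h1 : χ (p v₀) * χ (Groupoid.inv (p v₀)) = 1 := by
    rw [← hmul, Groupoid.comp_inv]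
    exact χ.map_one
  rw [hmul, hmul, mul_comm, mul_assoc, mul_comm (χ _) (χ (p v₀)), h1, mul_one]

/-! ### Eigenfunctions -/

/-- `g` is the derivative of `f` on each closed edge (one-sided at the end points). -/
def EdgeFun.HasDeriv (f g : G.EdgeFun ℂ) : Prop :=
  ∀ (e : G.E) (x : G.Seg e),
    HasDerivWithinAt (f.onLine e) (g e x) (Set.Icc 0 (G.length e)) x

theorem EdgeFun.HasDeriv.D_eq {f g : G.EdgeFun ℂ} (h : f.HasDeriv g) : f.D = g := by
  funext e x
  exact (h e x).derivWithin (EdgeFun.uniqueDiffWithinAt e x)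

theorem EdgeFun.HasDeriv.congr {f g g' : G.EdgeFun ℂ} (h : f.HasDeriv g) (hg : g = g') :
    f.HasDeriv g' := hg ▸ h

theorem EdgeFun.HasDeriv.continuousOn {f g : G.EdgeFun ℂ} (h : f.HasDeriv g) (e : G.E) :
    ContinuousOn (f.onLine e) (Set.Icc 0 (G.length e)) :=
  fun x hx => (h e ⟨x, hx⟩).continuousWithinAt

theorem EdgeFun.onLine_of_mem {F : Type} (f : G.EdgeFun F) {e : G.E} {x : ℝ}
    (hx : x ∈ Set.Icc 0 (G.length e)) : f.onLine e x = f e ⟨x, hx⟩ :=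
  f.onLine_val e ⟨x, hx⟩

theorem EdgeFun.HasDeriv.add {f f' g g' : G.EdgeFun ℂ} (hf : f.HasDeriv f') (hg : g.HasDeriv g') :
    (f + g).HasDeriv (f' + g') := fun e x => (hf e x).add (hg e x)

theorem EdgeFun.HasDeriv.sub {f f' g g' : G.EdgeFun ℂ} (hf : f.HasDeriv f') (hg : g.HasDeriv g') :
    (f - g).HasDeriv (f' - g') := fun e x => (hf e x).sub (hg e x)

theorem EdgeFun.HasDeriv.mul {f f' g g' : G.EdgeFun ℂ} (hf : f.HasDeriv f') (hg : g.HasDeriv g') :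
    EdgeFun.HasDeriv (f * g) (f' * g + f * g') := fun e x => by
  have h := (hf e x).mul (hg e x)
  rw [f.onLine_val, g.onLine_val] at h
  exact h

/-- The `1`-form `2πi α` as a complex edge function. -/
noncomputable def potential (α : G.oneForms) : G.EdgeFun ℂ :=
  fun e x => 2 * Real.pi * Complex.I * (α.1 e x : ℂ)

theorem dTwist_eq (α : G.oneForms) (f : G.EdgeFun ℂ) : dTwist α f = f.D + potential α * f := rfl

theorem potential_neg (α : G.oneForms) : potential (-α) = -potential α := by
  funext e x
  change 2 * Real.pi * Complex.I * ((-(α.1 e x) : ℝ) : ℂ) = -(2 * Real.pi * Complex.I * (α.1 e x : ℂ))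
  push_cast
  ring

theorem potential_zero : potential (0 : G.oneForms) = 0 := by
  funext e x
  change 2 * Real.pi * Complex.I * ((0 : ℝ) : ℂ) = 0
  simp

theorem potential_hasDeriv (α : G.oneForms) : (potential α).HasDeriv (potential α).D := by
  intro e x
  have h : DifferentiableWithinAt ℝ (fun t => 2 * Real.pi * Complex.I * (α.1.onLine e t : ℂ))
      (Set.Icc 0 (G.length e)) x :=
    (Complex.ofRealCLM.differentiableAt.comp_differentiableWithinAt _
      (α.2.1.differentiableWithinAt e x)).const_mul _
  exact h.hasDerivWithinAt

theorem continuousOn_D_potential (α : G.oneForms) (e : G.E) :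
    ContinuousOn ((potential α).D.onLine e) (Set.Icc 0 (G.length e)) := by
  have hs : (potential α).Smooth := fun e =>
    contDiffOn_const.mul (Complex.ofRealCLM.contDiff.comp_contDiffOn (α.2.1 e))
  exact (hs.D e).continuousOn

theorem outwardSum_mul_of_matches {f : G.EdgeFun ℂ} {u : G.V → ℂ}
    (hu : ∀ e, f e (G.start e) = u (G.init e) ∧ f e (G.finish e) = u (G.term e)) (g : G.EdgeFun ℂ)
    (w : G.V) : EdgeFun.outwardSum (f * g) w = u w * g.outwardSum w := by
  rw [EdgeFun.outwardSum, EdgeFun.outwardSum, mul_sub, Finset.mul_sum, Finset.mul_sum]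
  congr 1
  · refine Finset.sum_congr rfl fun e he => ?_
    obtain rfl : G.term e = w := by simpa using he
    rw [Pi.mul_apply, Pi.mul_apply, (hu e).2]
  · refine Finset.sum_congr rfl fun e he => ?_
    obtain rfl : G.init e = w := by simpa using he
    rw [Pi.mul_apply, Pi.mul_apply, (hu e).1]

/-- Continuity lets the common value of f at the vertex be taken out of the sum, and what remains is
the vertex condition on α. Hence f' and d_α f satisfy the same Kirchhoff condition. -/
theorem outwardSum_potential_mul (α : G.oneForms) {f : G.EdgeFun ℂ} (hf : f.MatchesAtVertices)
    (w : G.V) : EdgeFun.outwardSum (potential α * f) w = 0 := by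
  obtain ⟨u, hu⟩ := hf
  have h : ((α.1.outwardSum w : ℝ) : ℂ) = 0 := by rw [α.2.2, Complex.ofReal_zero]
  have h1 : (potential α).outwardSum w =
      2 * Real.pi * Complex.I * ((α.1.outwardSum w : ℝ) : ℂ) := by
    simp only [EdgeFun.outwardSum, potential, Complex.ofReal_sub, Complex.ofReal_sum, mul_sub,
      Finset.mul_sum]
  rw [mul_comm, outwardSum_mul_of_matches hu, h1, h, mul_zero, mul_zero]

/-! ### Regularity: from the weak equation to a pointwise system -/

theorem memW2_hasDeriv {f : G.EdgeFun ℂ} (hf : ∀ e, MemW2 (G.length e) (f e)) : f.HasDeriv f.D := by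
  intro e x
  obtain ⟨g, hg, -⟩ := (hf e).differentiableWithinAt
  exact (hg x x.2).differentiableWithinAt.hasDerivWithinAt

/-- The integral of a continuous derivative over an initial segment of an edge. -/
theorem eq_add_integral_of_hasDerivWithinAt {L : ℝ} {f g : ℝ → ℂ}
    (h : ∀ x ∈ Set.Icc 0 L, HasDerivWithinAt f (g x) (Set.Icc 0 L) x)
    (hg : ContinuousOn g (Set.Icc 0 L)) {x y : ℝ} (hx : x ∈ Set.Icc 0 L) (hy : y ∈ Set.Icc 0 L) :
    f y = f x + ∫ t in x..y, g t := by
  have hsub := Set.uIcc_subset_Icc hx hy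
  rw [intervalIntegral.integral_eq_sub_of_hasDeriv_right
    (f := f) (fun t ht => ((h t (hsub ht)).continuousWithinAt.mono hsub))
    (fun t ht => ?_) ((hg.mono hsub).intervalIntegrable)]
  · ring
  · have ht' : t ∈ Set.Ioo 0 L := by
      refine ⟨lt_of_le_of_lt ?_ ht.1, lt_of_lt_of_le ht.2 ?_⟩
      · exact le_min hx.1 hy.1
      · exact max_le hx.2 hy.2
    exact ((h t (Set.Ioo_subset_Icc_self ht')).hasDerivAt
      (Icc_mem_nhds ht'.1 ht'.2)).hasDerivWithinAt

theorem hasDerivWithinAt_of_eq_integral {F : Type*} [NormedAddCommGroup F] [NormedSpace ℝ F]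
    [CompleteSpace F] {L : ℝ} {f g : ℝ → F} (hg : ContinuousOn g (Set.Icc 0 L))
    (h : ∀ x ∈ Set.Icc 0 L, f x = f 0 + ∫ t in (0 : ℝ)..x, g t) {x : ℝ} (hx : x ∈ Set.Icc 0 L) :
    HasDerivWithinAt f (g x) (Set.Icc 0 L) x := by
  have hL : 0 ≤ L := hx.1.trans hx.2
  -- Extending the integrand constantly beyond the interval makes the fundamental theorem available
  -- at the end points too.
  have hc : Continuous (Set.IccExtend hL (Set.domRestrict (Set.Icc 0 L) g)) :=
    continuous_IccExtend_iff.2 hg.domRestrict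
  have he : ∀ t ∈ Set.Icc 0 L, Set.IccExtend hL (Set.domRestrict (Set.Icc 0 L) g) t = g t :=
    fun t ht => Set.IccExtend_of_mem hL _ ht
  have hd := (hc.integral_hasStrictDerivAt 0 x).hasDerivAt.const_add (f 0)
  rw [he x hx] at hd
  refine hd.hasDerivWithinAt.congr_of_mem (fun y hy => ?_) hx
  rw [h y hy]
  congr 1
  exact intervalIntegral.integral_congr fun t ht =>
    (he t (Set.uIcc_subset_Icc ⟨le_rfl, hL⟩ hy ht)).symm

theorem memW2_of_hasDeriv {f g h : G.EdgeFun ℂ} (hf : f.HasDeriv g) (hg : g.HasDeriv h) (e : G.E)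
    (hh : ContinuousOn (h.onLine e) (Set.Icc 0 (G.length e))) : MemW2 (G.length e) (f e) := by
  have h0 : (0 : ℝ) ∈ Set.Icc 0 (G.length e) := ⟨le_rfl, (G.length_pos e).le⟩
  have key {f g : G.EdgeFun ℂ} (hf : f.HasDeriv g)
      (hg : ContinuousOn (g.onLine e) (Set.Icc 0 (G.length e))) {x y : ℝ}
      (hx : x ∈ Set.Icc 0 (G.length e)) (hy : y ∈ Set.Icc 0 (G.length e)) :
      f.onLine e y = f.onLine e x + ∫ t in x..y, g.onLine e t := by
    refine eq_add_integral_of_hasDerivWithinAt (fun x hx => ?_) hg hx hy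
    rw [g.onLine_of_mem hx]
    exact hf e ⟨x, hx⟩
  refine ⟨g.onLine e, h.onLine e, ?_, fun x hx => key hg hh h0 hx, fun x y => ?_⟩
  · obtain ⟨C, hC⟩ := isCompact_Icc.exists_bound_of_continuousOn hh
    exact MemLp.of_bound (hh.aestronglyMeasurable measurableSet_Icc) C
      ((ae_restrict_iff' measurableSet_Icc).2 (Filter.Eventually.of_forall hC))
  · have := key hf (hg.continuousOn e) x.2 y.2
    rwa [f.onLine_val, f.onLine_val] at this

theorem ae_seg_iff (e : G.E) (P : ℝ → Prop) :
    (∀ᵐ (x : G.Seg e) ∂(G.segMeasure e), P x) ↔ ∀ᵐ x, x ∈ Set.Icc 0 (G.length e) → P x :=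
  (ae_restrict_iff_subtype (μ := volume) (p := P) measurableSet_Icc).symm.trans
    (ae_restrict_iff' measurableSet_Icc)

/-- The eigenvalue equation as a first order system of ordinary differential equations that holds
at every point. -/
def IsEigenfunction (α : G.oneForms) (z : ℂ) (f : G.EdgeFun ℂ) : Prop :=
  f.HasDeriv f.D ∧ (dTwist α f).HasDeriv (-(z • f) - potential α * dTwist α f) ∧
    f.MatchesAtVertices ∧ ∀ w, (dTwist α f).outwardSum w = 0

theorem outwardSum_dTwist (α : G.oneForms) {f : G.EdgeFun ℂ} (hf : f.MatchesAtVertices) (w : G.V) :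
    (dTwist α f).outwardSum w = f.D.outwardSum w := by
  rw [dTwist_eq, EdgeFun.outwardSum_add, outwardSum_potential_mul α hf, add_zero]

theorem IsEigenfunction.mem_eigenspace {α : G.oneForms} {z : ℂ} {f : G.EdgeFun ℂ}
    (h : IsEigenfunction α z f) : f ∈ eigenspace α z := by
  obtain ⟨hf, hg, hm, hk⟩ := h
  refine ⟨⟨fun e => ?_, hm, fun w => by rw [← outwardSum_dTwist α hm, hk]⟩, fun e => ?_⟩
  · have hp := potential_hasDeriv α
    -- The second derivative that W₂ requires comes from differentiating f' = d_α f - 2πi α f.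
    have hD : f.D.HasDeriv ((-(z • f) - potential α * dTwist α f) -
        ((potential α).D * f + potential α * f.D)) := by
      have h2 := hg.sub (hp.mul hf)
      rwa [dTwist_eq, add_sub_cancel_right, ← dTwist_eq] at h2
    refine memW2_of_hasDeriv hf hD e ?_
    have c1 := hf.continuousOn e
    have c2 := hg.continuousOn e
    have c3 := hp.continuousOn e
    have c4 := hD.continuousOn e
    have c5 := continuousOn_D_potential α e
    exact ((c1.const_smul z).neg.sub (c3.mul c2)).sub ((c5.mul c1).add (c3.mul c4))
  · refine Filter.Eventually.of_forall fun x => ?_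
    rw [schrodinger, dTwistAdjoint, hg.D_eq]
    simp [potential]

/-- Bootstrapping: the equation expresses the weak second derivative almost everywhere through f,
f', α and α', which are continuous. So f' is the integral of a continuous function and is
differentiable at every point. -/
theorem isEigenfunction_of_mem_eigenspace {α : G.oneForms} {z : ℂ} {f : G.EdgeFun ℂ}
    (h : f ∈ eigenspace α z) : IsEigenfunction α z f := by
  obtain ⟨⟨hW, hm, hk⟩, heq⟩ := h
  have hf := memW2_hasDeriv hW
  have hp := potential_hasDeriv α
  refine ⟨hf, ?_, hm, fun w => by rw [outwardSum_dTwist α hm, hk]⟩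
  -- This is f'' as solved from Δ_α f = z f.
  set r : G.EdgeFun ℂ := -(z • f) - potential α * dTwist α f -
    ((potential α).D * f + potential α * f.D) with hr
  suffices hD : f.D.HasDeriv r from
    EdgeFun.HasDeriv.congr (hD.add (hp.mul hf)) (by rw [hr, sub_add_cancel])
  intro e
  have hL := G.length_pos e
  have h0 : (0 : ℝ) ∈ Set.Icc 0 (G.length e) := ⟨le_rfl, hL.le⟩
  have h1 : G.length e ∈ Set.Icc 0 (G.length e) := ⟨hL.le, le_rfl⟩
  obtain ⟨g, h, hh, hg, hfg⟩ := hW e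
  have hgc := memW2_continuousOn hL hh hg
  have hDg : Set.EqOn (f.D.onLine e) g (Set.Icc 0 (G.length e)) := by
    intro x hx
    rw [EdgeFun.onLine_of_mem _ hx]
    refine HasDerivWithinAt.derivWithin ?_ (EdgeFun.uniqueDiffWithinAt e ⟨x, hx⟩)
    refine hasDerivWithinAt_of_eq_integral hgc (fun y hy => ?_) hx
    rw [EdgeFun.onLine_of_mem _ hy, EdgeFun.onLine_of_mem _ h0]
    exact hfg ⟨0, h0⟩ ⟨y, hy⟩
  have hrc : ContinuousOn (r.onLine e) (Set.Icc 0 (G.length e)) := by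
    have c1 := hf.continuousOn e
    have c3 := hp.continuousOn e
    have c4 : ContinuousOn (f.D.onLine e) (Set.Icc 0 (G.length e)) := hgc.congr hDg
    have c2 : ContinuousOn ((dTwist α f).onLine e) (Set.Icc 0 (G.length e)) := c4.add (c3.mul c1)
    have c5 := continuousOn_D_potential α e
    exact ((c1.const_smul z).neg.sub (c3.mul c2)).sub ((c5.mul c1).add (c3.mul c4))
  have hhr : ∀ᵐ x, x ∈ Set.Icc 0 (G.length e) → h x = r.onLine e x := by
    have hi := (memW2_intervalIntegrable hh h0 h1).ae_hasDerivAt_integral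
    -- The projection onto the interval turns the statement on the edge into a predicate on the real
    -- line, without changing it on the edge.
    have hs := (ae_seg_iff e (fun x => schrodinger α f e (Set.projIcc 0 _ hL.le x) =
      z * f e (Set.projIcc 0 _ hL.le x))).1 (by simpa using heq e)
    filter_upwards [hi, hs] with x hx hsx hmem
    rw [Set.uIcc_of_le hL.le] at hx
    have hg' : HasDerivWithinAt (f.D.onLine e) (h x) (Set.Icc 0 (G.length e)) x :=
      (((hx hmem 0 h0).const_add (g 0)).hasDerivWithinAt.congr hg (hg x hmem)).congr hDg
        (hDg hmem)
    have hT : (dTwist α f).D e ⟨x, hmem⟩ =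
        h x + ((potential α).D * f + potential α * f.D) e ⟨x, hmem⟩ :=
      (hg'.add (hp.mul hf e ⟨x, hmem⟩)).derivWithin (EdgeFun.uniqueDiffWithinAt e ⟨x, hmem⟩)
    have hsx' := hsx hmem
    rw [Set.projIcc_of_mem _ hmem] at hsx'
    have hS : schrodinger α f e ⟨x, hmem⟩ = -(dTwist α f).D e ⟨x, hmem⟩ -
      potential α e ⟨x, hmem⟩ * dTwist α f e ⟨x, hmem⟩ := rfl
    rw [EdgeFun.onLine_of_mem _ hmem, hr]
    rw [hS, hT] at hsx'
    simp only [Pi.sub_apply, Pi.neg_apply, Pi.smul_apply, Pi.mul_apply, Pi.add_apply,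
      smul_eq_mul] at hsx' ⊢
    linear_combination -hsx'
  -- The square integrable h may be replaced by the continuous r under the integral.
  have hgr (x : ℝ) (hx : x ∈ Set.Icc 0 (G.length e)) :
      g x = g 0 + ∫ t in (0 : ℝ)..x, r.onLine e t := by
    rw [hg x hx]
    congr 1
    refine intervalIntegral.integral_congr_ae ?_
    filter_upwards [hhr] with t ht ht'
    rw [Set.uIoc_of_le hx.1] at ht'
    exact ht ⟨ht'.1.le, ht'.2.trans hx.2⟩
  intro x
  have := hasDerivWithinAt_of_eq_integral hrc hgr x.2
  rw [r.onLine_val] at this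
  exact this.congr hDg (hDg x.2)

theorem mem_eigenspace_iff {α : G.oneForms} {z : ℂ} {f : G.EdgeFun ℂ} :
    f ∈ eigenspace α z ↔ IsEigenfunction α z f :=
  ⟨isEigenfunction_of_mem_eigenspace, IsEigenfunction.mem_eigenspace⟩

/-! ### Reality of the eigenvalues and complex conjugation -/

/-- The pointwise complex conjugate of an edge function. -/
noncomputable def EdgeFun.conj (f : G.EdgeFun ℂ) : G.EdgeFun ℂ := fun e x => starRingEnd ℂ (f e x)

theorem EdgeFun.conj_conj (f : G.EdgeFun ℂ) : f.conj.conj = f := by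
  funext e x
  exact Complex.conj_conj _

theorem EdgeFun.HasDeriv.conj {f g : G.EdgeFun ℂ} (h : f.HasDeriv g) : f.conj.HasDeriv g.conj :=
  fun e x => (h e x).star

theorem potential_conj (α : G.oneForms) : (potential α).conj = potential (-α) := by
  rw [potential_neg]
  funext e x
  simp [EdgeFun.conj, potential, map_ofNat (starRingEnd ℂ) 2]

theorem EdgeFun.outwardSum_conj (f : G.EdgeFun ℂ) (w : G.V) :
    f.conj.outwardSum w = starRingEnd ℂ (f.outwardSum w) := by
  simp [EdgeFun.outwardSum, EdgeFun.conj]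

theorem IsEigenfunction.conj {α : G.oneForms} {z : ℂ} {f : G.EdgeFun ℂ}
    (h : IsEigenfunction α z f) : IsEigenfunction (-α) (starRingEnd ℂ z) f.conj := by
  obtain ⟨hf, hg, ⟨u, hu⟩, hk⟩ := h
  have hT : dTwist (-α) f.conj = (dTwist α f).conj := by
    rw [dTwist_eq, ← potential_conj, hf.conj.D_eq]
    funext e x
    simp [EdgeFun.conj, dTwist_eq]
  refine ⟨?_, ?_, ⟨fun w => starRingEnd ℂ (u w), fun e => ?_⟩, fun w => ?_⟩
  · rw [hf.conj.D_eq]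
    exact hf.conj
  · rw [hT, ← potential_conj]
    refine hg.conj.congr ?_
    funext e x
    simp [EdgeFun.conj]
  · exact ⟨congrArg _ (hu e).1, congrArg _ (hu e).2⟩
  · rw [hT, EdgeFun.outwardSum_conj, hk, map_zero]

/-- Conjugation is only semilinear, but dimension is preserved since conjugation is an automorphism
of the scalars. -/
theorem rank_eigenspace_neg (α : G.oneForms) (z : ℂ) :
    Module.rank ℂ (eigenspace (-α) z) = Module.rank ℂ (eigenspace α (starRingEnd ℂ z)) := by
  have h1 {f : G.EdgeFun ℂ} (hf : f ∈ eigenspace (-α) z) :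
      f.conj ∈ eigenspace α (starRingEnd ℂ z) := by
    have := (mem_eigenspace_iff.1 hf).conj.mem_eigenspace
    rwa [neg_neg] at this
  have h2 {f : G.EdgeFun ℂ} (hf : f ∈ eigenspace α (starRingEnd ℂ z)) :
      f.conj ∈ eigenspace (-α) z := by
    have := (mem_eigenspace_iff.1 hf).conj.mem_eigenspace
    rwa [Complex.conj_conj] at this
  refine rank_eq_of_equiv_equiv (starRingEnd ℂ)
    { toFun := fun f => ⟨f.1.conj, h1 f.2⟩
      invFun := fun f => ⟨f.1.conj, h2 f.2⟩
      left_inv := fun f => Subtype.ext f.1.conj_conj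
      right_inv := fun f => Subtype.ext f.1.conj_conj
      map_add' := fun f g => Subtype.ext <| by
        funext e x
        exact map_add (starRingEnd ℂ) (f.1 e x) (g.1 e x) }
    (Function.Involutive.bijective Complex.conj_conj) fun c f => Subtype.ext <| by
      funext e x
      exact map_mul (starRingEnd ℂ) c (f.1 e x)

theorem sum_outwardSum [Fintype G.V] [Fintype G.E] {F : Type} [AddCommGroup F] (a : G.EdgeFun F) :
    ∑ w, a.outwardSum w = ∑ e, (a e (G.finish e) - a e (G.start e)) := by
  classical
  simp only [EdgeFun.outwardSum, Finset.sum_sub_distrib]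
  congr 1
  · rw [← Finset.sum_fiberwise Finset.univ G.term]
    refine Finset.sum_congr rfl fun w _ => Finset.sum_congr ?_ fun _ _ => rfl
    ext; simp
  · rw [← Finset.sum_fiberwise Finset.univ G.init]
    refine Finset.sum_congr rfl fun w _ => Finset.sum_congr ?_ fun _ _ => rfl
    ext; simp

/-- Symmetry of Δ_α: with g = d_α f one has (f̄ g)' = |g|² - z|f|², the potential terms cancelling
because 2πi α is imaginary. Over the whole graph the boundary terms sum to zero by continuity and
Kirchhoff, so the imaginary part gives Im z · ∫|f|² = 0. -/
theorem eigenspace_eq_bot [Finite G.V] [Finite G.E] (α : G.oneForms) {z : ℂ} (hz : z.im ≠ 0) :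
    eigenspace α z = ⊥ := by
  cases nonempty_fintype G.V
  cases nonempty_fintype G.E
  rw [eq_bot_iff]
  intro f hf
  obtain ⟨hd, hg, ⟨u, hu⟩, hk⟩ := mem_eigenspace_iff.1 hf
  set g := dTwist α f with hgdef
  have hfD : f.D = g - potential α * f := by rw [hgdef, dTwist_eq, add_sub_cancel_right]
  have hw := hd.conj.mul hg
  have hsum : ∑ e, ((f.conj * g) e (G.finish e) - (f.conj * g) e (G.start e)) = 0 := by
    rw [← sum_outwardSum]
    refine Finset.sum_eq_zero fun w _ => ?_
    rw [outwardSum_mul_of_matches (u := fun w => starRingEnd ℂ (u w))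
      (fun e => ⟨congrArg _ (hu e).1, congrArg _ (hu e).2⟩), hk, mul_zero]
  have hcont (e : G.E) : ContinuousOn (fun t => Complex.normSq (f.onLine e t))
      (Set.Icc 0 (G.length e)) := Complex.continuous_normSq.comp_continuousOn (hd.continuousOn e)
  have hint (e : G.E) : z.im * ∫ t in (0 : ℝ)..G.length e, Complex.normSq (f.onLine e t) =
      -((f.conj * g) e (G.finish e) - (f.conj * g) e (G.start e)).im := by
    have hL := (G.length_pos e).le
    have hder (x : ℝ) (hx : x ∈ Set.Icc 0 (G.length e)) :
        HasDerivWithinAt (fun t => (EdgeFun.onLine (f.conj * g) e t).im)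
          (-z.im * Complex.normSq (f.onLine e x)) (Set.Icc 0 (G.length e)) x := by
      have h := (Complex.imCLM.hasFDerivAt.comp_hasDerivWithinAt x (hw e ⟨x, hx⟩))
      refine h.congr_deriv ?_
      rw [hfD, EdgeFun.onLine_of_mem _ hx]
      simp only [EdgeFun.conj, Pi.add_apply, Pi.mul_apply, Pi.sub_apply, Pi.neg_apply,
        Pi.smul_apply, smul_eq_mul, potential, Complex.imCLM_apply]
      simp [Complex.normSq_apply]
      ring
    have hI := intervalIntegral.integral_eq_sub_of_hasDerivAt_of_le hL
      (fun x hx => (hder x hx).continuousWithinAt)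
      (fun x hx => (hder x (Set.Ioo_subset_Icc_self hx)).hasDerivAt (Icc_mem_nhds hx.1 hx.2))
      (by
        apply ContinuousOn.intervalIntegrable
        rw [Set.uIcc_of_le hL]
        exact (hcont e).const_mul _)
    rw [intervalIntegral.integral_const_mul] at hI
    rw [EdgeFun.onLine_of_mem _ ⟨hL, le_rfl⟩, EdgeFun.onLine_of_mem _ ⟨le_rfl, hL⟩] at hI
    change _ = ((f.conj * g) e (G.finish e)).im - ((f.conj * g) e (G.start e)).im at hI
    rw [Complex.sub_im]
    linarith
  have hzero : ∑ e, ∫ t in (0 : ℝ)..G.length e, Complex.normSq (f.onLine e t) = 0 := by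
    refine (mul_eq_zero.1 ?_).resolve_left hz
    rw [Finset.mul_sum, Finset.sum_congr rfl fun e _ => hint e, Finset.sum_neg_distrib,
      ← Complex.im_sum, hsum, Complex.zero_im, neg_zero]
  have hnonneg (e : G.E) : 0 ≤ ∫ t in (0 : ℝ)..G.length e, Complex.normSq (f.onLine e t) :=
    intervalIntegral.integral_nonneg (G.length_pos e).le fun t _ => Complex.normSq_nonneg _
  rw [Submodule.mem_bot]
  funext e x
  have he := (Finset.sum_eq_zero_iff_of_nonneg fun e _ => hnonneg e).1 hzero e (Finset.mem_univ e)
  -- A continuous nonnegative function with zero integral vanishes at every point, end points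
  -- included.
  by_contra hne
  refine (intervalIntegral.integral_pos (G.length_pos e) (hcont e)
    (fun t _ => Complex.normSq_nonneg _) ⟨x, x.2, ?_⟩).ne' he
  rw [f.onLine_val]
  exact Complex.normSq_pos.2 hne

theorem spec_neg [Finite G.V] [Finite G.E] (α : G.oneForms) : spec (-α) = spec α := by
  funext z
  rw [spec, spec, rank_eigenspace_neg]
  by_cases hz : z.im = 0
  · rw [Complex.conj_eq_iff_im.2 hz]
  · rw [eigenspace_eq_bot α hz, eigenspace_eq_bot α (z := starRingEnd ℂ z) (by simpa using hz)]

/-! ### Gauge transformation to the universal cover -/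

/-- The lift of the vertex `w` given by the path class `p`. -/
def coverVertex {v₀ w : G.V} (p : G.PathClass v₀ w) : (G.universalCover v₀).V := ⟨w, p⟩

/-- The lift of the edge `e` that starts at the lift of `init e` given by `p`. -/
def coverEdge {v₀ : G.V} (e : G.E) (p : G.PathClass v₀ (G.init e)) : (G.universalCover v₀).E :=
  ⟨e, p⟩

theorem init_coverEdge {v₀ : G.V} (e : G.E) (p : G.PathClass v₀ (G.init e)) :
    (G.universalCover v₀).init (coverEdge e p) = coverVertex p := rfl

theorem term_coverEdge {v₀ : G.V} (e : G.E) (p : G.PathClass v₀ (G.init e)) :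
    (G.universalCover v₀).term (coverEdge e p) = coverVertex (p ≫ edgePath e) := rfl

theorem coverVertex_inj {v₀ w : G.V} {p q : G.PathClass v₀ w} :
    coverVertex p = coverVertex q ↔ p = q := by
  refine ⟨fun h => ?_, congrArg _⟩
  simpa using Sigma.mk.inj_iff.1 h

theorem exists_coverEdge {v₀ : G.V} (e : (G.universalCover v₀).E) : ∃ e' p, e = coverEdge e' p :=
  ⟨e.1, e.2, rfl⟩

/-- The phase of the integral of `α` along a path and then along an initial segment of an edge, as
a function on the universal cover. -/
noncomputable def gauge (v₀ : G.V) (α : G.oneForms) : (G.universalCover v₀).EdgeFun ℂ :=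
  fun e (x : G.Seg e.1) =>
    (phase (pathIntegral α e.2 + ∫ t in (0 : ℝ)..x, α.1.onLine e.1 t) : ℂ)

theorem gauge_ne_zero (v₀ : G.V) (α : G.oneForms) (e : (G.universalCover v₀).E)
    (x : (G.universalCover v₀).Seg e) : gauge v₀ α e x ≠ 0 := Circle.coe_ne_zero _

/-- The pull-back of a function to the universal cover. -/
def pullback (v₀ : G.V) (f : G.EdgeFun ℂ) : (G.universalCover v₀).EdgeFun ℂ :=
  fun e (x : G.Seg e.1) => f e.1 x

/-- Here and in `gauge_finish` the value at an end point depends only on the vertex of the cover;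
this is the continuity of the gauge function. -/
theorem gauge_start {v₀ : G.V} (α : G.oneForms) (e : G.E) (p : G.PathClass v₀ (G.init e)) :
    gauge v₀ α (coverEdge e p) ((G.universalCover v₀).start _) = phase (pathIntegral α p) := by
  change (phase (pathIntegral α p + ∫ t in (0 : ℝ)..0, α.1.onLine e t) : ℂ) = _
  rw [intervalIntegral.integral_same, add_zero]

theorem gauge_finish {v₀ : G.V} (α : G.oneForms) (e : G.E) (p : G.PathClass v₀ (G.init e)) :
    gauge v₀ α (coverEdge e p) ((G.universalCover v₀).finish _) =
      phase (pathIntegral α (p ≫ edgePath e)) := by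
  rw [pathIntegral_comp, pathIntegral_edgePath]
  rfl

theorem gauge_smul (v₀ : G.V) (α : G.oneForms) (γ : G.FundGroup v₀) (e : (G.universalCover v₀).E)
    (x : (G.universalCover v₀).Seg e) :
    gauge v₀ α (γ • e) x = character v₀ α γ * gauge v₀ α e x := by
  have h (t : ℝ) : phase (pathIntegral α (γ ≫ e.2) + t) =
      phase (pathIntegral α γ) * phase (pathIntegral α e.2 + t) := by
    rw [← phase_add, ← add_assoc, ← pathIntegral_comp]
  exact (congrArg ((↑) : Circle → ℂ) (h _)).trans (Circle.coe_mul _ _)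

theorem gauge_hasDeriv (v₀ : G.V) (α : G.oneForms) :
    (gauge v₀ α).HasDeriv (pullback v₀ (potential (-α)) * gauge v₀ α) := by
  rintro ⟨e, p⟩ ⟨x, hx⟩
  change x ∈ Set.Icc 0 (G.length e) at hx
  have hα := hasDerivWithinAt_of_eq_integral (f := fun y => ∫ t in (0 : ℝ)..y, α.1.onLine e t)
    (α.2.1 e).continuousOn (fun y _ => by simp) hx
  have h := (((hα.const_add (pathIntegral α p)).ofReal_comp.const_mul
    (-2 * Real.pi * Complex.I)).cexp)
  have hval (y : ℝ) (hy : y ∈ Set.Icc 0 (G.length e)) : (gauge v₀ α).onLine (coverEdge e p) y =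
      Complex.exp (-2 * Real.pi * Complex.I *
        ((pathIntegral α p + ∫ t in (0 : ℝ)..y, α.1.onLine e t : ℝ) : ℂ)) :=
    (EdgeFun.onLine_of_mem (G := G.universalCover v₀) (gauge v₀ α) (e := coverEdge e p) hy).trans
      (coe_phase _)
  refine (h.congr hval (hval x hx)).congr_deriv ?_
  change _ = potential (-α) e ⟨x, hx⟩ * gauge v₀ α (coverEdge e p) ⟨x, hx⟩
  rw [← EdgeFun.onLine_of_mem (G := G.universalCover v₀) (gauge v₀ α) (e := coverEdge e p) hx,
    hval x hx, α.1.onLine_of_mem hx, potential_neg]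
  simp only [Pi.neg_apply, potential]
  ring

theorem pullback_hasDeriv_iff (v₀ : G.V) (hne : ∀ w, Nonempty (G.PathClass v₀ w))
    {f g : G.EdgeFun ℂ} : (pullback v₀ f).HasDeriv (pullback v₀ g) ↔ f.HasDeriv g :=
  ⟨fun h e x => h ⟨e, (hne _).some⟩ x, fun h e x => h e.1 x⟩

/-- The transformation from functions on the graph to functions on the universal cover. -/
noncomputable def gaugeLift (v₀ : G.V) (α : G.oneForms) :
    G.EdgeFun ℂ →ₗ[ℂ] (G.universalCover v₀).EdgeFun ℂ where
  toFun f := gauge v₀ α * pullback v₀ f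
  map_add' f g := mul_add (gauge v₀ α) (pullback v₀ f) (pullback v₀ g)
  map_smul' c f := mul_smul_comm c (gauge v₀ α) (pullback v₀ f)

theorem gaugeLift_apply (v₀ : G.V) (α : G.oneForms) (f : G.EdgeFun ℂ) :
    gaugeLift v₀ α f = gauge v₀ α * pullback v₀ f := rfl

theorem gaugeLift_injective (hG : G.Connected) (v₀ : G.V) (α : G.oneForms) :
    Function.Injective (gaugeLift v₀ α) := by
  intro f g h
  funext e x
  obtain ⟨p⟩ := hG.exists_pathClass v₀ (G.init e)
  exact mul_left_cancel₀ (gauge_ne_zero v₀ α ⟨e, p⟩ x) (congrFun (congrFun h ⟨e, p⟩) x)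

/-- An equivariant function is determined by its values on one lift of each edge, and the gauge
function is itself equivariant. Dividing by it on the chosen lifts gives the preimage. -/
theorem range_gaugeLift (hG : G.Connected) (v₀ : G.V) (α : G.oneForms) :
    LinearMap.range (gaugeLift v₀ α) = equivariant (character v₀ α) := by
  ext F
  constructor
  · rintro ⟨f, rfl⟩ γ e x
    refine (congrArg (· * pullback v₀ f e x) (gauge_smul v₀ α γ e x)).trans ?_
    exact mul_assoc _ _ _
  · intro hF
    obtain ⟨p⟩ : Nonempty (∀ w, G.PathClass v₀ w) := ⟨fun w => (hG.exists_pathClass v₀ w).some⟩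
    refine ⟨fun e x => (gauge v₀ α (coverEdge e (p _)) x)⁻¹ * F (coverEdge e (p _)) x, ?_⟩
    funext ⟨e, q⟩ x
    -- Any two lifts of the same edge differ by a deck transformation.
    obtain ⟨γ, rfl⟩ : ∃ γ : G.FundGroup v₀, q = γ ≫ p (G.init e) :=
      ⟨q ≫ Groupoid.inv (p (G.init e)), by simp⟩
    have h1 := hF γ (coverEdge e (p _)) x
    have h2 := gauge_smul v₀ α γ (coverEdge e (p _)) x
    have h3 := gauge_ne_zero v₀ α (coverEdge e (p _)) x
    refine (congrArg (· * _) h2).trans (Eq.trans ?_ h1.symm)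
    exact (mul_assoc _ _ _).trans (congrArg _ (mul_inv_cancel_left₀ h3 _))

/-- Multiplication by the gauge function turns the covariant derivative into the derivative. -/
theorem gauge_mul_hasDeriv_iff (v₀ : G.V) (α : G.oneForms)
    {f g : (G.universalCover v₀).EdgeFun ℂ} :
    EdgeFun.HasDeriv (gauge v₀ α * f) (gauge v₀ α * g) ↔
      f.HasDeriv (g - pullback v₀ (potential (-α)) * f) := by
  have hφ := gauge_hasDeriv v₀ α
  constructor
  · intro h e x
    have hne : ∀ e x, gauge v₀ α e x ≠ 0 := gauge_ne_zero v₀ α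
    have hinv : HasDerivWithinAt (fun y => ((gauge v₀ α).onLine e y)⁻¹) _ _ x :=
      HasDerivWithinAt.fun_inv (hφ e x) (by rw [EdgeFun.onLine_val]; exact hne e x)
    have h2 := hinv.mul (h e x)
    rw [EdgeFun.onLine_val, EdgeFun.onLine_val] at h2
    refine (h2.congr (fun y hy => ?_) ?_).congr_deriv ?_
    · simp only [Pi.mul_apply]
      rw [EdgeFun.onLine_of_mem _ hy, EdgeFun.onLine_of_mem _ hy, EdgeFun.onLine_of_mem _ hy,
        Pi.mul_apply, Pi.mul_apply, inv_mul_cancel_left₀ (hne _ _)]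
    · simp only [Pi.mul_apply]
      rw [EdgeFun.onLine_val, EdgeFun.onLine_val, EdgeFun.onLine_val,
        Pi.mul_apply, Pi.mul_apply, inv_mul_cancel_left₀ (hne _ _)]
    · have := hne e x
      simp only [Pi.mul_apply, Pi.sub_apply]
      field_simp
      ring
  · intro h
    refine (hφ.mul h).congr ?_
    ring

/-! ### Vertex conditions and eigenspaces under the lift -/

theorem gaugeLift_start {v₀ : G.V} (α : G.oneForms) (f : G.EdgeFun ℂ) (e : G.E)
    (p : G.PathClass v₀ (G.init e)) :
    gaugeLift v₀ α f (coverEdge e p) ((G.universalCover v₀).start _) =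
      phase (pathIntegral α p) * f e (G.start e) :=
  congrArg (· * f e (G.start e)) (gauge_start α e p)

theorem gaugeLift_finish {v₀ : G.V} (α : G.oneForms) (f : G.EdgeFun ℂ) (e : G.E)
    (p : G.PathClass v₀ (G.init e)) :
    gaugeLift v₀ α f (coverEdge e p) ((G.universalCover v₀).finish _) =
      phase (pathIntegral α (p ≫ edgePath e)) * f e (G.finish e) :=
  congrArg (· * f e (G.finish e)) (gauge_finish α e p)

/-- The covering map is bijective on the edge ends at a vertex, and the gauge function has one
common value at all of them. -/
theorem gaugeLift_outwardSum {v₀ w : G.V} (α : G.oneForms) (f : G.EdgeFun ℂ)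
    (p : G.PathClass v₀ w) :
    (gaugeLift v₀ α f).outwardSum (coverVertex p) =
      phase (pathIntegral α p) * f.outwardSum w := by
  rw [EdgeFun.outwardSum, EdgeFun.outwardSum, mul_sub, Finset.mul_sum, Finset.mul_sum]
  congr 1
  · refine Finset.sum_bij (fun e _ => e.1) ?_ ?_ ?_ ?_
    · intro e he
      rw [Set.Finite.mem_toFinset] at he ⊢
      exact congrArg Sigma.fst he
    · intro a ha b hb hab
      obtain ⟨e, q, rfl⟩ := exists_coverEdge a
      obtain ⟨e', q', rfl⟩ := exists_coverEdge b
      obtain rfl : e = e' := hab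
      rw [Set.Finite.mem_toFinset, Set.mem_ofPred_eq, term_coverEdge] at ha hb
      have h := ha.trans hb.symm
      rw [(cancel_mono _).1 (coverVertex_inj.1 h)]
    · intro e he
      obtain rfl : G.term e = w := by simpa using he
      -- The lift of e that ends at p starts at p followed by e backwards.
      refine ⟨coverEdge e (p ≫ Groupoid.inv (edgePath e)), ?_, rfl⟩
      rw [Set.Finite.mem_toFinset, Set.mem_ofPred_eq, term_coverEdge, coverVertex_inj]
      simp
    · intro e he
      obtain ⟨e, q, rfl⟩ := exists_coverEdge e
      rw [Set.Finite.mem_toFinset, Set.mem_ofPred_eq, term_coverEdge] at he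
      obtain rfl : G.term e = w := congrArg Sigma.fst he
      rw [gaugeLift_finish, coverVertex_inj.1 he]
      rfl
  · refine Finset.sum_bij (fun e _ => e.1) ?_ ?_ ?_ ?_
    · intro e he
      rw [Set.Finite.mem_toFinset] at he ⊢
      exact congrArg Sigma.fst he
    · intro a ha b hb hab
      obtain ⟨e, q, rfl⟩ := exists_coverEdge a
      obtain ⟨e', q', rfl⟩ := exists_coverEdge b
      obtain rfl : e = e' := hab
      rw [Set.Finite.mem_toFinset, Set.mem_ofPred_eq, init_coverEdge] at ha hb
      have h := ha.trans hb.symm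
      rw [coverVertex_inj.1 h]
    · intro e he
      obtain rfl : G.init e = w := by simpa using he
      refine ⟨coverEdge e p, ?_, rfl⟩
      rw [Set.Finite.mem_toFinset, Set.mem_ofPred_eq, init_coverEdge]
    · intro e he
      obtain ⟨e, q, rfl⟩ := exists_coverEdge e
      rw [Set.Finite.mem_toFinset, Set.mem_ofPred_eq, init_coverEdge] at he
      obtain rfl : G.init e = w := congrArg Sigma.fst he
      rw [gaugeLift_start, coverVertex_inj.1 he]
      rfl

theorem gaugeLift_matches_iff (hG : G.Connected) (v₀ : G.V) (α : G.oneForms) (f : G.EdgeFun ℂ) :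
    (gaugeLift v₀ α f).MatchesAtVertices ↔ f.MatchesAtVertices := by
  constructor
  · rintro ⟨U, hU⟩
    obtain ⟨p⟩ : Nonempty (∀ w, G.PathClass v₀ w) := ⟨fun w => (hG.exists_pathClass v₀ w).some⟩
    refine ⟨fun w => (phase (pathIntegral α (p w)) : ℂ)⁻¹ * U (coverVertex (p w)),
      fun e => ⟨?_, ?_⟩⟩
    · have h := (hU (coverEdge e (p _))).1
      rw [gaugeLift_start, init_coverEdge] at h
      rw [eq_inv_mul_iff_mul_eq₀ (Circle.coe_ne_zero _), h]
    · have h := (hU (coverEdge e (p _ ≫ Groupoid.inv (edgePath e)))).2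
      rw [gaugeLift_finish, term_coverEdge, Category.assoc, Groupoid.inv_comp,
        Category.comp_id] at h
      rw [eq_inv_mul_iff_mul_eq₀ (Circle.coe_ne_zero _), h]
  · rintro ⟨u, hu⟩
    refine ⟨fun w => phase (pathIntegral α w.2) * u w.1, fun e => ?_⟩
    obtain ⟨e, p, rfl⟩ := exists_coverEdge e
    rw [gaugeLift_start, gaugeLift_finish, (hu e).1, (hu e).2]
    exact ⟨rfl, rfl⟩

/-- Each line of the first order system for -α on the graph corresponds to the same line for the
zero form on the cover, because differentiation after multiplication by the gauge function is d_{-α}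
before it. -/
theorem gaugeLift_mem_eigenspace_iff (hG : G.Connected) (v₀ : G.V) (α : G.oneForms) (z : ℂ)
    (f : G.EdgeFun ℂ) :
    gaugeLift v₀ α f ∈ eigenspace (0 : (G.universalCover v₀).oneForms) z ↔
      f ∈ eigenspace (-α) z := by
  have hne := hG.exists_pathClass v₀
  have h1 (f g : G.EdgeFun ℂ) : (gaugeLift v₀ α f).HasDeriv (gaugeLift v₀ α g) ↔
      f.HasDeriv (g - potential (-α) * f) := by
    rw [gaugeLift_apply, gaugeLift_apply, gauge_mul_hasDeriv_iff,
      ← pullback_hasDeriv_iff v₀ hne]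
    rfl
  have h0 (F : (G.universalCover v₀).EdgeFun ℂ) : dTwist 0 F = F.D := by
    rw [dTwist_eq, potential_zero, zero_mul, add_zero]
  have hD : (gaugeLift v₀ α f).HasDeriv (gaugeLift v₀ α f).D ↔ f.HasDeriv f.D := by
    constructor
    · intro h
      -- Writing the derivative as a multiple of the gauge function brings it into the form to which
      -- `gauge_mul_hasDeriv_iff` applies.
      have h2 : EdgeFun.HasDeriv (gauge v₀ α * pullback v₀ f)
          (gauge v₀ α * ((gauge v₀ α)⁻¹ * (gaugeLift v₀ α f).D)) := by
        refine h.congr ?_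
        funext e x
        exact (mul_inv_cancel_left₀ (gauge_ne_zero v₀ α e x) _).symm
      rw [gauge_mul_hasDeriv_iff] at h2
      intro e x
      exact (h2 ⟨e, (hne _).some⟩ x).differentiableWithinAt.hasDerivWithinAt
    · intro h e x
      refine HasDerivWithinAt.differentiableWithinAt (f' := gaugeLift v₀ α (dTwist (-α) f) e x)
        ?_ |>.hasDerivWithinAt
      refine (h1 f (dTwist (-α) f)).2 (h.congr ?_) e x
      rw [dTwist_eq, add_sub_cancel_right]
  rw [mem_eigenspace_iff, mem_eigenspace_iff, IsEigenfunction, IsEigenfunction, hD,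
    gaugeLift_matches_iff hG, h0]
  refine and_congr_right fun hf => ?_
  have hT : (gaugeLift v₀ α f).D = gaugeLift v₀ α (dTwist (-α) f) := by
    refine EdgeFun.HasDeriv.D_eq ((h1 _ _).2 (hf.congr ?_))
    rw [dTwist_eq, add_sub_cancel_right]
  rw [hT]
  refine and_congr ?_ (and_congr_right fun _ => ?_)
  · rw [potential_zero, zero_mul, sub_zero, ← map_smul, ← map_neg, h1]
  · constructor
    · intro h w
      have := h (coverVertex (hne w).some)
      rw [gaugeLift_outwardSum] at this
      exact (mul_eq_zero.1 this).resolve_left (Circle.coe_ne_zero _)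
    · rintro h ⟨w, p⟩
      exact (gaugeLift_outwardSum α _ p).trans (by rw [h, mul_zero])

theorem piOneSpec_character [Finite G.V] [Finite G.E] (hG : G.Connected) (v₀ : G.V)
    (α : G.oneForms) : piOneSpec (character v₀ α) = spec α := by
  rw [← spec_neg]
  funext z
  have h : (eigenspace (-α) z).map (gaugeLift v₀ α) =
      eigenspace (0 : (G.universalCover v₀).oneForms) z ⊓ equivariant (character v₀ α) := by
    rw [← range_gaugeLift hG]
    ext F
    constructor
    · rintro ⟨f, hf, rfl⟩
      exact ⟨(gaugeLift_mem_eigenspace_iff hG v₀ α z f).2 hf, f, rfl⟩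
    · rintro ⟨hF, f, rfl⟩
      exact ⟨f, (gaugeLift_mem_eigenspace_iff hG v₀ α z f).1 hF, rfl⟩
  have hr := ((eigenspace (-α) z).equivMapOfInjective _ (gaugeLift_injective hG v₀ α)).lift_rank_eq
  rw [piOneSpec, spec, ← h]
  -- The function spaces of graph and cover live in different universes; lifting does not affect the
  -- value in `ℕ∞`.
  have := congrArg Cardinal.toENat hr
  rw [Cardinal.toENat_lift, Cardinal.toENat_lift] at this
  exact this.symm

end MetricGraph

/-! ### Descent to the torus -/

theorem mainTheorem11 (G : MetricGraph.{u, v}) [Finite G.V] [Finite G.E] [Nonempty G.E]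
    (hG : G.Connected) (v₀ : G.V) :
    ∃ (Φ : G.BlochTorus → (G.FundGroup v₀ →* Circle)) (Bl : G.BlochTorus → ℂ → ℕ∞),
      (∀ (α : G.oneForms) (γ : G.FundGroup v₀),
        (Φ (MetricGraph.torusClass α) γ : ℂ) =
          Complex.exp (-2 * Real.pi * Complex.I * (MetricGraph.pathIntegral α γ : ℂ))) ∧
      Function.Bijective Φ ∧
      (∀ α : G.oneForms, Bl (MetricGraph.torusClass α) = MetricGraph.spec α) ∧
      ∀ t : G.BlochTorus, MetricGraph.piOneSpec (Φ t) = Bl t := by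
  have hsurj : Function.Surjective (MetricGraph.torusClass (G := G)) :=
    QuotientAddGroup.mk_surjective.comp (Submodule.mkQ_surjective _)
  have hΦ (α : G.oneForms) : MetricGraph.character v₀ (Function.surjInv hsurj
      (MetricGraph.torusClass α)) = MetricGraph.character v₀ α :=
    (MetricGraph.character_eq_iff hG v₀ _ _).2 (Function.surjInv_eq hsurj _)
  -- Both maps use an arbitrary representative, which is harmless by `hΦ`. With the Bloch spectrum
  -- defined through the character, the coincidence of the spectra is definitional, and the content
  -- moves to the claim that it equals Spec_α for every α.
  refine ⟨fun t => MetricGraph.character v₀ (Function.surjInv hsurj t),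
    fun t => MetricGraph.piOneSpec (MetricGraph.character v₀ (Function.surjInv hsurj t)),
    fun α γ => ?_, ⟨fun s t h => ?_, fun χ => ?_⟩, fun α => ?_, fun t => rfl⟩
  · simp only [hΦ]
    rw [MetricGraph.character_apply, MetricGraph.coe_phase]
  · have h' := (MetricGraph.character_eq_iff hG v₀ _ _).1 h
    rwa [Function.surjInv_eq hsurj, Function.surjInv_eq hsurj] at h'
  · obtain ⟨α, rfl⟩ := MetricGraph.character_surjective hG v₀ χ
    exact ⟨MetricGraph.torusClass α, hΦ α⟩
  · simp only [hΦ]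
    exact MetricGraph.piOneSpec_character hG v₀ α
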